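/- **Setting.** Let $V=V_1\times\dots\times V_Q$ be a product of discrete sets; a subgroup $S\subseteq V$ is *rectangular* if $S=S_1\times\dots\times S_Q$ with $S_j\subseteq V_j$. Test data $D=\{(x_i,y_i)\}_{i\le N}$ are i.i.d. from a law $f$ on $V\times\{0,1\}$, with marginal $f_X$ and $p(x)=\mathbb P(Y=1\mid X=x)$. Training data $\widetilde D$, independent of $D$, consist of $n$ i.i.d. records from a law $\widetilde f$ on $V\times\{0,1\}$ with marginal $\widetilde f_X$. A (possibly randomized) classifier trained on $\widetilde D$ produces predicted probabilities $\hat p(x)\in[0,1]$, $x \in V$. The Bias Scan score of $S$ and its maximum over rectangular subgroups are $$F(S)=\sup_{0<q<1}\Big(\sum_{i:\,x_i\in S} y_i\log q-\sum_{i:\,x_i\in S}\log\big(1-\hat p(x_i)+q\,\hat p(x_i)\big)\Big),\qquad F^*=\sup_{S\ \mathrm{rectangular}}F(S).$$ **Assumptions.** No bias: $\widetilde{\mathbb P}(Y=1\mid X=x)=p(x)$ for all $x\in\operatorname{supp} f_X$. (A1) The classifier is consistent: for every $x\in\operatorname{supp}\widetilde f_X$, $\hat p(x)\to\widetilde{\mathbb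 P}(Y=1\mid X=x)$ in probability as $n\to\infty$. (A2) $\operatorname{supp}\widetilde f_X\supseteq\operatorname{supp} f_X$. (A3) $0<p(x)<1$ for all $x\in\operatorname{supp} f_X$. (A4) The number $M=|\operatorname{supp} f_X|$ of covariate profiles is finite, fixed as $n, N\to\infty$, and sufficiently large, as specified below. **Theorem.** Let $G$ be a standard Gaussian variable, $\Phi$ its cdf, and let $k_1,k_2\ge 0$ be given by $$k_1=\max_{t>0}\mathbb E\big[\max(tG-\tfrac{t^2}{2},0)\big],\qquad k_2^2=\max_{t>0}\operatorname{Var}\big[\max(tG-\tfrac{t^2}{2},0)\big]$$ (the maxima are attained). Then $|k_1-0.202|\le 0.0005$ and $|k_2-0.523|\le 0.0005$. Put $$h(\alpha)=k_1M+k_2\,\Phi^{-1}(1-\alpha)\sqrt M .$$ For every $0<\alpha<\tfrac12$ there is an $M_0$, depending only on $\alpha$, such that, under no bias and (A1)–(A4) with $M\ge M_0$, $$\limsup_{N\to\infty}\ \limsup_{n\to\infty}\ \mathbb P\big(F^*>h(\alpha)\big)\le\alpha .$$ For $\alpha=\tfrac12$, the same holds with the right-hand side replaced by $\alpha+\varepsilon$,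 for every $\varepsilon>0$ and all $M\ge M_0(\varepsilon)$. -/

import Mathlib

open MeasureTheory ProbabilityTheory Filter Topology

universe u w

namespace BiasScan

noncomputable section

/-! ### Records, joint laws, samples

A record is a pair `(x, y)` of a covariate profile `x : V` and a binary outcome `y : Bool`
(`true` stands for `Y = 1`). A joint law of `(X, Y)` is a probability mass function. -/

/-- The marginal law `f_X` of the covariates under the joint law `f`. -/
def covariateLaw {V : Type u} (f : PMF (V × Bool)) : PMF V := f.map Prod.fst

/-- `ℙ(Y = 1 | X = x)` under the joint law `f` (meaningful when `x` is in the support of `f_X`). -/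
def condProb {V : Type u} (f : PMF (V × Bool)) (x : V) : ℝ :=
  (f (x, true)).toReal / (covariateLaw f x).toReal

/-- The law of a data set of `n` records drawn i.i.d. from the joint law `f`. -/
def sampleLaw {V : Type u} [MeasurableSpace V] (f : PMF (V × Bool)) (n : ℕ) :
    Measure (Fin n → V × Bool) :=
  Measure.pi fun _ => f.toMeasure

/-! ### Bias Scan -/

open Classical in
/-- The Bernoulli log-likelihood ratio, at odds multiplier `q`, of the subgroup `S` for the data
`D = (x_i, y_i)` and the predicted probabilities `p x_i`:
`∑_{x_i ∈ S} y_i log q - ∑_{x_i ∈ S} log (1 - p x_i + q p x_i)`. -/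
def logLikelihoodRatio {V : Type u} {N : ℕ} (p : V → ℝ) (D : Fin N → V × Bool) (S : Set V)
    (q : ℝ) : ℝ :=
  (∑ i with (D i).1 ∈ S, (if (D i).2 then (1 : ℝ) else 0) * Real.log q)
    - ∑ i with (D i).1 ∈ S, Real.log (1 - p (D i).1 + q * p (D i).1)

/-- The Bias Scan score `F(S)`, the supremum over `0 < q < 1` of the log-likelihood ratio. -/
def score {V : Type u} {N : ℕ} (p : V → ℝ) (D : Fin N → V × Bool) (S : Set V) : EReal :=
  ⨆ q ∈ Set.Ioo (0 : ℝ) 1, (logLikelihoodRatio p D S q : EReal)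

/-- A subgroup is rectangular if it is a product `S_1 × ... × S_Q` of sets of attribute values. -/
def IsRectangular {Q : ℕ} {Val : Fin Q → Type u} (S : Set (∀ j, Val j)) : Prop :=
  ∃ T : ∀ j, Set (Val j), S = Set.univ.pi T

/-- The Bias Scan score `F*`, maximized over all rectangular subgroups. -/
def maxScore {Q : ℕ} {Val : Fin Q → Type u} {N : ℕ} (p : (∀ j, Val j) → ℝ)
    (D : Fin N → (∀ j, Val j) × Bool) : EReal :=
  ⨆ S ∈ {S : Set (∀ j, Val j) | IsRectangular S}, score p D S

/-! ### Classifiers -/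

/-- A classifier (learning algorithm), possibly randomized through a random seed: it turns a
training set of any size `n` into predicted probabilities of `Y = 1` for every profile. -/
structure Classifier (V : Type u) [MeasurableSpace V] where
  /-- the space of random seeds (a point, for a deterministic algorithm) -/
  Seed : Type w
  [seedSpace : MeasurableSpace Seed]
  /-- the law of the random seed -/
  seedLaw : Measure Seed
  [isProbabilityMeasure_seedLaw : IsProbabilityMeasure seedLaw]
  /-- the predicted probability of `Y = 1` for a profile -/
  predict : (n : ℕ) → (Fin n → V × Bool) → Seed → V → ℝ
  measurable_predict : ∀ n x,
    Measurable fun z : (Fin n → V × Bool) × Seed => predict n z.1 z.2 x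
  predict_mem_Icc : ∀ n D s x, predict n D s x ∈ Set.Icc (0 : ℝ) 1

attribute [instance] Classifier.seedSpace Classifier.isProbabilityMeasure_seedLaw

/-- The joint law of a training set of size `n`, drawn i.i.d. from `f`, and an independent seed. -/
def Classifier.trainLaw {V : Type u} [MeasurableSpace V] (c : Classifier.{u, w} V)
    (f : PMF (V × Bool)) (n : ℕ) : Measure ((Fin n → V × Bool) × c.Seed) :=
  (sampleLaw f n).prod c.seedLaw

/-- Consistency for learning the conditional law of `Y` given `X` from data drawn i.i.d. from `f`:
for every `x` in the support of `f_X`, the predicted probability converges in probability to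
`ℙ(Y = 1 | X = x)` as the number of training records tends to infinity. -/
def Classifier.IsConsistent {V : Type u} [MeasurableSpace V] (c : Classifier.{u, w} V)
    (f : PMF (V × Bool)) : Prop :=
  ∀ x ∈ (covariateLaw f).support, ∀ ε : ℝ, 0 < ε →
    Tendsto (fun n : ℕ => c.trainLaw f n {z | ε ≤ |c.predict n z.1 z.2 x - condProb f x|})
      atTop (𝓝 0)

/-- `ℙ(F* > h)`, when the classifier `c` is trained on `n` records drawn i.i.d. from `ftrain` and
Bias Scan assesses its predictions on `N` test records drawn i.i.d. from `ftest`, independently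
of the training stage. -/
def exceedProb {Q : ℕ} {Val : Fin Q → Type u} [∀ j, MeasurableSpace (Val j)]
    (c : Classifier.{u, w} (∀ j, Val j)) (ftrain ftest : PMF ((∀ j, Val j) × Bool))
    (n N : ℕ) (h : ℝ) : ENNReal :=
  ((sampleLaw ftest N).prod (c.trainLaw ftrain n))
    {z | (h : EReal) < maxScore (c.predict n z.2.1 z.2.2) z.1}

/-! ### The threshold -/

/-- The Gaussian quantile function `Φ⁻¹` (on `(0, 1)`, where `Φ` is the standard Gaussian cdf). -/
def gaussianQuantile (r : ℝ) : ℝ := sInf {z : ℝ | r ≤ cdf (gaussianReal 0 1) z}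

/-- The limiting positive part of the contribution of one profile to the score, as a function of a
standard Gaussian variable `g` and of `t = Z √(p (1 - p)) > 0`, where `q = 1 - Z / √n`. -/
def censoredContribution (t g : ℝ) : ℝ := max (t * g - t ^ 2 / 2) 0

/-- The expectation of the censored Gaussian contribution. -/
def censoredMean (t : ℝ) : ℝ := ∫ g, censoredContribution t g ∂(gaussianReal 0 1)

/-- The variance of the censored Gaussian contribution. -/
def censoredVariance (t : ℝ) : ℝ := Var[censoredContribution t; gaussianReal 0 1]

/-- The critical value `h(α) = k₁ M + k₂ Φ⁻¹(1 - α) √M`. -/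
def threshold (k₁ k₂ : ℝ) (M : ℕ) (α : ℝ) : ℝ :=
  k₁ * M + k₂ * gaussianQuantile (1 - α) * √M

end

end BiasScan

/-! Put q = exp(-u). A record with success probability p and outcome y contributes at most (p - y)u
- p(1 - p)u²/(2 + u) to the log-likelihood ratio (`record_le`). Summed over the records of one
profile x, with u of order N^(-1/2), this is essentially tH - t²/2, where H is the normalized
residual sum of x and t = Z a with a = `profileScale` of x and a factor Z common to all profiles. A
profile outside S contributes 0, so each profile is bounded by the positive part of its term, and
all subgroups are handled at once by the supremum over Z of the sum of `censoredContribution (Z * a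
x) (H x)`. As N grows, the H x become independent standard Gaussians, because the residuals of
different profiles have disjoint supports and hence are uncorrelated.

For a fixed Z the mean and variance of this sum are at most k₁M and k₂²M. The difficulty is the
supremum over Z when the scales a x are arbitrary and unequal. The sum is compared with the one in
which every profile sits at the scale `optScale` maximizing the mean. The mean has a quadratic gap
below its maximum (`callMean_half_le`), and the second moment of the difference `excess` is
controlled by the same squared distance. Hence, for one fixed r > 0, E exp(r * excess) ≤ 1 at every
scale (`exists_integral_exp_mul_excess_le_one`). Chernoff's inequality then makes an excess of δ√M
exponentially unlikely in √M, and a net of polynomially many values of Z suffices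
(`sum_censoredContribution_le_of_notMem_exceedSet`).

What remains is an i.i.d. sum at `optScale`, with mean k₁ per term and a standard deviation `optDev`
strictly below k₂, since the variance peaks at a larger scale than the mean. For α < 1/2 the
quantile is positive, and the gap between `optDev` and k₂ pays for δ√M and for all additive
constants (`exists_slack`); at α = 1/2 the slack comes from ε. These estimates do not involve the
scales a x, so M₀ depends only on α and ε.

For fixed N, letting n tend to infinity replaces the predictions by the true probabilities at an
additive cost of 1. Then N tends to infinity, using the law of large numbers for the counts and the
central limit theorem on the closed set `exceedSet`. The constants k₁, k₂ are obtained from closed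
forms in the Gaussian tail; log-concavity of its iterated integrals makes each derivative change
sign exactly once, and Taylor bounds locate the zeros. -/

namespace BiasScan

noncomputable section

/-! ### The standard Gaussian density, tail and truncated moments -/

/-- The standard Gaussian density. -/
def stdDensity (x : ℝ) : ℝ := (√(2 * Real.pi))⁻¹ * Real.exp (-x ^ 2 / 2)

/-- The upper tail of the standard Gaussian law. -/
def stdTail (s : ℝ) : ℝ := ∫ x in Set.Ioi s, stdDensity x

/-- The expectation of `(G - s)⁺` for a standard Gaussian `G`. -/
def stdCall (s : ℝ) : ℝ := stdDensity s - s * stdTail s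

/-- The expectation of `((G - s)⁺) ^ 2` for a standard Gaussian `G`. -/
def stdSqCall (s : ℝ) : ℝ := (1 + s ^ 2) * stdTail s - s * stdDensity s

lemma stdDensity_eq (x : ℝ) : stdDensity x = gaussianPDFReal 0 1 x := by
  simp [stdDensity, gaussianPDFReal]

lemma stdDensity_pos (x : ℝ) : 0 < stdDensity x := by
  unfold stdDensity; positivity

lemma hasDerivAt_stdDensity (x : ℝ) : HasDerivAt stdDensity (-x * stdDensity x) x := by
  have h : HasDerivAt (fun x : ℝ => -x ^ 2 / 2) (-x) x := by
    exact ((hasDerivAt_pow 2 x).neg.div_const 2).congr_deriv (by push_cast; ring)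
  exact (h.exp.const_mul (√(2 * Real.pi))⁻¹).congr_deriv (by unfold stdDensity; ring)

lemma continuous_stdDensity : Continuous stdDensity := by
  unfold stdDensity; fun_prop

lemma integrable_stdDensity : Integrable stdDensity := by
  have := integrable_gaussianPDFReal 0 1
  exact this.congr (Eventually.of_forall fun x => (stdDensity_eq x).symm)

lemma stdTail_zero : stdTail 0 = 1 / 2 := by
  unfold stdTail stdDensity
  rw [integral_const_mul]
  have := integral_gaussian_Ioi (1 / 2)
  have h2 : ∀ x : ℝ, Real.exp (-x ^ 2 / 2) = Real.exp (-(1 / 2) * x ^ 2) := fun x => by ring_nf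
  simp_rw [h2, this]
  rw [show Real.pi / (1 / 2) = 2 * Real.pi by ring]
  have : √(2 * Real.pi) ≠ 0 := by positivity
  field_simp

lemma stdTail_eq (s : ℝ) : stdTail s = 1 / 2 - ∫ x in (0 : ℝ)..s, stdDensity x := by
  have := intervalIntegral.integral_Ioi_sub_Ioi' (a := 0) (b := s) (f := stdDensity) (μ := volume)
    integrable_stdDensity.integrableOn integrable_stdDensity.integrableOn
  rw [← this, ← stdTail_zero]; simp [stdTail]

lemma hasDerivAt_stdTail (s : ℝ) : HasDerivAt stdTail (-stdDensity s) s := by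
  have h : HasDerivAt (fun s => 1 / 2 - ∫ x in (0 : ℝ)..s, stdDensity x) (-stdDensity s) s :=
    (continuous_stdDensity.integral_hasStrictDerivAt 0 s).hasDerivAt.const_sub _
  exact h.congr_of_eventuallyEq (Eventually.of_forall stdTail_eq)

lemma hasDerivAt_stdCall (s : ℝ) : HasDerivAt stdCall (-stdTail s) s := by
  exact ((hasDerivAt_stdDensity s).sub ((hasDerivAt_id s).mul (hasDerivAt_stdTail s))).congr_deriv
    (by simp)

lemma hasDerivAt_stdSqCall (s : ℝ) : HasDerivAt stdSqCall (-(2 * stdCall s)) s := by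
  exact ((((hasDerivAt_pow 2 s).const_add 1).mul (hasDerivAt_stdTail s)).sub
    ((hasDerivAt_id s).mul (hasDerivAt_stdDensity s))).congr_deriv (by simp [stdCall]; ring)

lemma continuous_stdTail : Continuous stdTail :=
  continuous_iff_continuousAt.2 fun s => (hasDerivAt_stdTail s).continuousAt

lemma continuous_stdCall : Continuous stdCall :=
  continuous_iff_continuousAt.2 fun s => (hasDerivAt_stdCall s).continuousAt

lemma continuous_stdSqCall : Continuous stdSqCall :=
  continuous_iff_continuousAt.2 fun s => (hasDerivAt_stdSqCall s).continuousAt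

/-! ### Behaviour at infinity and positivity -/

lemma tendsto_pow_mul_stdDensity (n : ℕ) :
    Tendsto (fun x => x ^ n * stdDensity x) atTop (𝓝 0) := by
  have h := Real.tendsto_pow_mul_exp_neg_atTop_nhds_zero n
  have h2 : Tendsto (fun x : ℝ => (√(2 * Real.pi))⁻¹ * (x ^ n * Real.exp (-x))) atTop (𝓝 0) := by
    simpa using h.const_mul (√(2 * Real.pi))⁻¹
  refine squeeze_zero' ?_ ?_ h2
  · filter_upwards [eventually_ge_atTop 0] with x hx
    have := stdDensity_pos x
    positivity
  · filter_upwards [eventually_ge_atTop 2] with x hx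
    have : Real.exp (-x ^ 2 / 2) ≤ Real.exp (-x) := Real.exp_le_exp.2 (by nlinarith)
    unfold stdDensity
    have h3 : 0 ≤ x ^ n := by positivity
    have h4 : 0 ≤ (√(2 * Real.pi))⁻¹ := by positivity
    calc x ^ n * ((√(2 * Real.pi))⁻¹ * Real.exp (-x ^ 2 / 2))
        = (√(2 * Real.pi))⁻¹ * (x ^ n * Real.exp (-x ^ 2 / 2)) := by ring
      _ ≤ _ := by gcongr

lemma stdTail_nonneg (s : ℝ) : 0 ≤ stdTail s :=
  integral_nonneg fun x => (stdDensity_pos x).le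

/-- Beyond 1 the density is dominated by x times itself, which is minus its own derivative and
integrates exactly. -/
lemma stdTail_le_stdDensity {s : ℝ} (hs : 1 ≤ s) : stdTail s ≤ stdDensity s := by
  have hlim : Tendsto (fun x => -stdDensity x) atTop (𝓝 0) := by
    simpa using (tendsto_pow_mul_stdDensity 0).neg
  have hderiv : ∀ x ∈ Set.Ioi s, HasDerivAt (fun x => -stdDensity x) (x * stdDensity x) x :=
    fun x _ => (hasDerivAt_stdDensity x).neg.congr_deriv (by ring)
  have hcont : ContinuousWithinAt (fun x => -stdDensity x) (Set.Ici s) s :=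
    (continuous_stdDensity.neg).continuousWithinAt
  have hnn : ∀ x ∈ Set.Ioi s, 0 ≤ x * stdDensity x := fun x hx =>
    mul_nonneg (by linarith [Set.mem_Ioi.1 hx]) (stdDensity_pos x).le
  have h1 := integral_Ioi_of_hasDerivAt_of_nonneg hcont hderiv hnn hlim
  have h2 := integrableOn_Ioi_deriv_of_nonneg hcont hderiv hnn hlim
  calc stdTail s ≤ ∫ x in Set.Ioi s, x * stdDensity x := by
        refine setIntegral_mono_on integrable_stdDensity.integrableOn h2 measurableSet_Ioi ?_
        intro x hx
        have := stdDensity_pos x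
        nlinarith [Set.mem_Ioi.1 hx]
    _ = stdDensity s := by rw [h1]; simp

lemma tendsto_pow_mul_stdTail (n : ℕ) :
    Tendsto (fun x => x ^ n * stdTail x) atTop (𝓝 0) := by
  refine squeeze_zero' ?_ ?_ (tendsto_pow_mul_stdDensity n)
  · filter_upwards [eventually_ge_atTop 0] with x hx
    have := stdTail_nonneg x
    positivity
  · filter_upwards [eventually_ge_atTop 1] with x hx
    have := stdTail_le_stdDensity hx
    gcongr

lemma tendsto_stdTail : Tendsto stdTail atTop (𝓝 0) := by
  simpa using tendsto_pow_mul_stdTail 0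

lemma tendsto_stdCall : Tendsto stdCall atTop (𝓝 0) := by
  have := (tendsto_pow_mul_stdDensity 0).sub (tendsto_pow_mul_stdTail 1)
  simp only [pow_zero, one_mul, pow_one, sub_zero] at this
  exact this

lemma tendsto_stdSqCall : Tendsto stdSqCall atTop (𝓝 0) := by
  have := ((tendsto_pow_mul_stdTail 0).add (tendsto_pow_mul_stdTail 2)).sub
    (tendsto_pow_mul_stdDensity 1)
  simp only [pow_zero, one_mul, pow_one, add_zero, sub_zero] at this
  refine this.congr fun x => ?_
  unfold stdSqCall; ring

/-- A function with nonpositive derivative beyond `s` that vanishes at infinity is nonnegative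
at `s`. -/
lemma nonneg_of_deriv_nonpos_of_tendsto {f f' : ℝ → ℝ} {s : ℝ}
    (hf : ∀ x, s ≤ x → HasDerivAt f (f' x) x) (hf' : ∀ x, s ≤ x → f' x ≤ 0)
    (hlim : Tendsto f atTop (𝓝 0)) : 0 ≤ f s := by
  have hanti : AntitoneOn f (Set.Ici s) := by
    refine antitoneOn_of_hasDerivWithinAt_nonpos (convex_Ici s)
      (fun x hx => (hf x hx).continuousAt.continuousWithinAt)
      (fun x hx => (hf x (interior_subset hx)).hasDerivWithinAt) ?_
    exact fun x hx => hf' x (interior_subset hx)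
  refine le_of_tendsto hlim ?_
  filter_upwards [eventually_ge_atTop s] with x hx
  exact hanti (Set.mem_Ici.2 le_rfl) hx hx

/-- A function with negative derivative beyond `s` that vanishes at infinity is positive at `s`. -/
lemma pos_of_deriv_neg_of_tendsto {f f' : ℝ → ℝ} {s : ℝ}
    (hf : ∀ x, s ≤ x → HasDerivAt f (f' x) x) (hf' : ∀ x, s ≤ x → f' x < 0)
    (hlim : Tendsto f atTop (𝓝 0)) : 0 < f s := by
  have hanti : StrictAntiOn f (Set.Ici s) := by
    refine strictAntiOn_of_hasDerivWithinAt_neg (convex_Ici s)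
      (fun x hx => (hf x hx).continuousAt.continuousWithinAt)
      (fun x hx => (hf x (interior_subset hx)).hasDerivWithinAt) ?_
    exact fun x hx => hf' x (interior_subset hx)
  have h1 : 0 ≤ f (s + 1) := nonneg_of_deriv_nonpos_of_tendsto (s := s + 1)
    (fun x hx => hf x (by linarith)) (fun x hx => (hf' x (by linarith)).le) hlim
  have h2 := hanti (Set.mem_Ici.2 le_rfl) (Set.mem_Ici.2 (by linarith : s ≤ s + 1)) (by linarith)
  linarith

lemma stdTail_pos (s : ℝ) : 0 < stdTail s :=
  pos_of_deriv_neg_of_tendsto (fun x _ => hasDerivAt_stdTail x)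
    (fun x _ => neg_neg_of_pos (stdDensity_pos x)) tendsto_stdTail

lemma stdCall_pos (s : ℝ) : 0 < stdCall s :=
  pos_of_deriv_neg_of_tendsto (fun x _ => hasDerivAt_stdCall x)
    (fun x _ => neg_neg_of_pos (stdTail_pos x)) tendsto_stdCall

lemma strictAnti_stdTail : StrictAnti stdTail :=
  strictAnti_of_hasDerivAt_neg hasDerivAt_stdTail fun x => neg_neg_of_pos (stdDensity_pos x)

lemma strictAnti_stdCall : StrictAnti stdCall :=
  strictAnti_of_hasDerivAt_neg hasDerivAt_stdCall fun x => neg_neg_of_pos (stdTail_pos x)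

/-! ### Log-concavity of the iterated tails -/

lemma hasDerivAt_hazard (x : ℝ) : HasDerivAt (fun x => stdDensity x / stdTail x)
    (stdDensity x * stdCall x / stdTail x ^ 2) x := by
  exact ((hasDerivAt_stdDensity x).div (hasDerivAt_stdTail x) (stdTail_pos x).ne').congr_deriv
    (by simp only [stdCall]; ring)

/-- Log-concavity of `stdCall`, whose first two derivatives are `-stdTail` and `stdDensity`. The
hazard rate is increasing, so freezing it at s makes `stdTail - hazard * stdCall` decreasing beyond
s; this function vanishes at infinity, hence is nonnegative at s. -/
lemma stdDensity_mul_stdCall_le (s : ℝ) : stdDensity s * stdCall s ≤ stdTail s ^ 2 := by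
  have hmono : Monotone fun x => stdDensity x / stdTail x :=
    monotone_of_hasDerivAt_nonneg hasDerivAt_hazard fun x =>
      div_nonneg (mul_nonneg (stdDensity_pos x).le (stdCall_pos x).le) (sq_nonneg _)
  have h : 0 ≤ stdTail s - stdDensity s / stdTail s * stdCall s := by
    refine nonneg_of_deriv_nonpos_of_tendsto
      (f := fun x => stdTail x - stdDensity s / stdTail s * stdCall x)
      (fun x _ => (hasDerivAt_stdTail x).sub ((hasDerivAt_stdCall x).const_mul _)) ?_ ?_
    · intro x hx
      have h1 := hmono hx
      have h2 := stdTail_pos x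
      simp only at h1
      rw [le_div_iff₀ h2] at h1
      linarith
    · simpa using tendsto_stdTail.sub (tendsto_stdCall.const_mul (stdDensity s / stdTail s))
  have h2 := stdTail_pos s
  have h3 : stdDensity s / stdTail s * stdCall s * stdTail s = stdDensity s * stdCall s := by
    field_simp
  nlinarith

lemma hasDerivAt_stdTail_div_stdCall (x : ℝ) : HasDerivAt (fun x => stdTail x / stdCall x)
    ((stdTail x ^ 2 - stdDensity x * stdCall x) / stdCall x ^ 2) x := by
  exact ((hasDerivAt_stdTail x).div (hasDerivAt_stdCall x) (stdCall_pos x).ne').congr_deriv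
    (by ring)

lemma monotone_stdTail_div_stdCall : Monotone fun x => stdTail x / stdCall x :=
  monotone_of_hasDerivAt_nonneg hasDerivAt_stdTail_div_stdCall fun x =>
    div_nonneg (sub_nonneg.2 (stdDensity_mul_stdCall_le x)) (sq_nonneg _)

/-- Log-concavity of `stdSqCall`, by the same argument one integration further, with `stdTail /
stdCall` in place of the hazard rate. -/
lemma stdTail_mul_stdSqCall_le (s : ℝ) : stdTail s * stdSqCall s ≤ 2 * stdCall s ^ 2 := by
  have h : 0 ≤ 2 * stdCall s - stdTail s / stdCall s * stdSqCall s := by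
    refine nonneg_of_deriv_nonpos_of_tendsto
      (f := fun x => 2 * stdCall x - stdTail s / stdCall s * stdSqCall x)
      (fun x _ => ((hasDerivAt_stdCall x).const_mul 2).sub
        ((hasDerivAt_stdSqCall x).const_mul _)) ?_ ?_
    · intro x hx
      have h1 := monotone_stdTail_div_stdCall hx
      have h2 := stdCall_pos x
      simp only at h1
      rw [le_div_iff₀ h2] at h1
      linarith
    · simpa using (tendsto_stdCall.const_mul 2).sub
        (tendsto_stdSqCall.const_mul (stdTail s / stdCall s))
  have h2 := stdCall_pos s
  have h3 : stdTail s / stdCall s * stdSqCall s * stdCall s = stdTail s * stdSqCall s := by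
    field_simp
  nlinarith

/-! ### Closed forms of the censored moments -/

lemma integral_gaussianReal_eq (f : ℝ → ℝ) :
    ∫ g, f g ∂(gaussianReal 0 1) = ∫ x, stdDensity x * f x := by
  rw [integral_gaussianReal_eq_integral_smul one_ne_zero]
  simp [stdDensity_eq]

lemma integral_Ioi_sub_mul_stdDensity (s : ℝ) :
    IntegrableOn (fun x => (x - s) * stdDensity x) (Set.Ioi s) ∧
      ∫ x in Set.Ioi s, (x - s) * stdDensity x = stdCall s := by
  have hderiv : ∀ x, HasDerivAt (fun x => -stdDensity x + s * stdTail x)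
      ((x - s) * stdDensity x) x := fun x =>
    ((hasDerivAt_stdDensity x).neg.add ((hasDerivAt_stdTail x).const_mul s)).congr_deriv (by ring)
  have hlim : Tendsto (fun x => -stdDensity x + s * stdTail x) atTop (𝓝 0) := by
    simpa using (tendsto_pow_mul_stdDensity 0).neg.add (tendsto_stdTail.const_mul s)
  have hnn : ∀ x ∈ Set.Ioi s, 0 ≤ (x - s) * stdDensity x := fun x hx =>
    mul_nonneg (by linarith [Set.mem_Ioi.1 hx]) (stdDensity_pos x).le
  refine ⟨integrableOn_Ioi_deriv_of_nonneg (hderiv s).continuousAt.continuousWithinAt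
    (fun x _ => hderiv x) hnn hlim, ?_⟩
  rw [integral_Ioi_of_hasDerivAt_of_nonneg (hderiv s).continuousAt.continuousWithinAt
    (fun x _ => hderiv x) hnn hlim]
  unfold stdCall; ring

lemma integral_Ioi_sub_sq_mul_stdDensity (s : ℝ) :
    IntegrableOn (fun x => (x - s) ^ 2 * stdDensity x) (Set.Ioi s) ∧
      ∫ x in Set.Ioi s, (x - s) ^ 2 * stdDensity x = stdSqCall s := by
  have hderiv : ∀ x, HasDerivAt
      (fun x => -(x * stdDensity x) + 2 * s * stdDensity x - (1 + s ^ 2) * stdTail x)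
      ((x - s) ^ 2 * stdDensity x) x := fun x =>
    (((((hasDerivAt_id x).mul (hasDerivAt_stdDensity x)).neg.add
      ((hasDerivAt_stdDensity x).const_mul (2 * s)))).sub
      ((hasDerivAt_stdTail x).const_mul (1 + s ^ 2))).congr_deriv (by simp; ring)
  have hlim : Tendsto
      (fun x => -(x * stdDensity x) + 2 * s * stdDensity x - (1 + s ^ 2) * stdTail x)
      atTop (𝓝 0) := by
    simpa using ((tendsto_pow_mul_stdDensity 1).neg.add
      ((tendsto_pow_mul_stdDensity 0).const_mul (2 * s))).sub
      (tendsto_stdTail.const_mul (1 + s ^ 2))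
  have hnn : ∀ x ∈ Set.Ioi s, 0 ≤ (x - s) ^ 2 * stdDensity x := fun x _ =>
    mul_nonneg (sq_nonneg _) (stdDensity_pos x).le
  refine ⟨integrableOn_Ioi_deriv_of_nonneg (hderiv s).continuousAt.continuousWithinAt
    (fun x _ => hderiv x) hnn hlim, ?_⟩
  rw [integral_Ioi_of_hasDerivAt_of_nonneg (hderiv s).continuousAt.continuousWithinAt
    (fun x _ => hderiv x) hnn hlim]
  unfold stdSqCall; ring

lemma stdDensity_mul_censoredContribution {t : ℝ} (ht : 0 < t) (x : ℝ) :
    stdDensity x * censoredContribution t x =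
      (Set.Ioi (t / 2)).indicator (fun x => t * ((x - t / 2) * stdDensity x)) x := by
  unfold censoredContribution
  by_cases hx : t / 2 < x
  · rw [Set.indicator_of_mem (Set.mem_Ioi.2 hx), max_eq_left (by nlinarith)]; ring
  · rw [Set.indicator_of_notMem (by simpa using hx), max_eq_right (by nlinarith), mul_zero]

lemma stdDensity_mul_censoredContribution_sq {t : ℝ} (ht : 0 < t) (x : ℝ) :
    stdDensity x * censoredContribution t x ^ 2 =
      (Set.Ioi (t / 2)).indicator (fun x => t ^ 2 * ((x - t / 2) ^ 2 * stdDensity x)) x := by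
  unfold censoredContribution
  by_cases hx : t / 2 < x
  · rw [Set.indicator_of_mem (Set.mem_Ioi.2 hx), max_eq_left (by nlinarith)]; ring
  · rw [Set.indicator_of_notMem (by simpa using hx), max_eq_right (by nlinarith)]; ring

/-- The mean of the censored contribution at `t = 2 s`. -/
def callMean (s : ℝ) : ℝ := 2 * s * stdCall s

/-- The variance of `(G - s)⁺`. -/
def callVar (s : ℝ) : ℝ := stdSqCall s - stdCall s ^ 2

lemma censoredMean_eq {t : ℝ} (ht : 0 < t) : censoredMean t = callMean (t / 2) := by
  unfold censoredMean callMean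
  rw [integral_gaussianReal_eq]
  simp_rw [stdDensity_mul_censoredContribution ht]
  rw [integral_indicator measurableSet_Ioi, integral_const_mul,
    (integral_Ioi_sub_mul_stdDensity _).2]
  ring

lemma continuous_censoredContribution (t : ℝ) : Continuous (censoredContribution t) := by
  unfold censoredContribution; fun_prop

lemma integral_censoredContribution_sq {t : ℝ} (ht : 0 < t) :
    ∫ g, censoredContribution t g ^ 2 ∂(gaussianReal 0 1) = t ^ 2 * stdSqCall (t / 2) := by
  rw [integral_gaussianReal_eq]
  simp_rw [stdDensity_mul_censoredContribution_sq ht]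
  rw [integral_indicator measurableSet_Ioi, integral_const_mul,
    (integral_Ioi_sub_sq_mul_stdDensity _).2]

lemma abs_censoredContribution_le {t : ℝ} (ht : 0 ≤ t) (g : ℝ) :
    |censoredContribution t g| ≤ t * |g| := by
  unfold censoredContribution
  rw [abs_of_nonneg (le_max_right _ _)]
  refine max_le ?_ (by positivity)
  nlinarith [le_abs_self g, sq_nonneg t]

lemma memLp_censoredContribution {t : ℝ} (ht : 0 ≤ t) :
    MemLp (censoredContribution t) 2 (gaussianReal 0 1) := by
  refine MemLp.of_le_mul (c := t) (memLp_id_gaussianReal 2)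
    (continuous_censoredContribution t).aestronglyMeasurable (Eventually.of_forall fun g => ?_)
  simpa using abs_censoredContribution_le ht g

lemma censoredVariance_eq {t : ℝ} (ht : 0 < t) :
    censoredVariance t = 4 * (t / 2) ^ 2 * callVar (t / 2) := by
  unfold censoredVariance callVar
  rw [variance_eq_sub (memLp_censoredContribution ht.le)]
  have h1 := integral_censoredContribution_sq ht
  have h2 := censoredMean_eq ht
  unfold censoredMean callMean at h2
  simp only [Pi.pow_apply]
  rw [h1, h2]; ring

/-! ### The maximum of the mean -/

lemma hasDerivAt_callMean (s : ℝ) :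
    HasDerivAt callMean (2 * (stdCall s - s * stdTail s)) s :=
  (((hasDerivAt_id s).const_mul 2).mul (hasDerivAt_stdCall s)).congr_deriv (by simp; ring)

lemma hasDerivAt_stdCall_sub (s : ℝ) :
    HasDerivAt (fun s => stdCall s - s * stdTail s) (s * stdDensity s - 2 * stdTail s) s :=
  ((hasDerivAt_stdCall s).sub ((hasDerivAt_id s).mul (hasDerivAt_stdTail s))).congr_deriv
    (by simp; ring)

/-- The derivative of `callMean` is 2 * `stdCall` times one minus this function, so monotonicity
here means that it changes sign at most once on the half-line. -/
lemma strictMonoOn_mul_stdTail_div_stdCall :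
    StrictMonoOn (fun s => s * (stdTail s / stdCall s)) (Set.Ici 0) := by
  intro x hx y hy hxy
  have h1 := monotone_stdTail_div_stdCall hxy.le
  have h2 : 0 < stdTail y / stdCall y := div_pos (stdTail_pos y) (stdCall_pos y)
  have h3 : 0 < stdTail x / stdCall x := div_pos (stdTail_pos x) (stdCall_pos x)
  simp only at h1 ⊢
  nlinarith [Set.mem_Ici.1 hx]

lemma stdCall_sub_eq (s : ℝ) :
    stdCall s - s * stdTail s = stdCall s * (1 - s * (stdTail s / stdCall s)) := by
  have := (stdCall_pos s).ne'
  field_simp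

lemma stdCall_sub_pos_of_lt {s c : ℝ} (hs : 0 ≤ s) (hsc : s < c)
    (hc : 0 ≤ stdCall c - c * stdTail c) : 0 < stdCall s - s * stdTail s := by
  have h := strictMonoOn_mul_stdTail_div_stdCall (Set.mem_Ici.2 hs)
    (Set.mem_Ici.2 (hs.trans hsc.le)) hsc
  rw [stdCall_sub_eq] at hc ⊢
  have h1 := nonneg_of_mul_nonneg_right hc (stdCall_pos c)
  simp only at h
  exact mul_pos (stdCall_pos s) (by linarith)

lemma stdCall_sub_neg_of_lt {s c : ℝ} (hc : 0 ≤ c) (hcs : c < s)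
    (h0 : stdCall c - c * stdTail c ≤ 0) : stdCall s - s * stdTail s < 0 := by
  by_contra h
  have := stdCall_sub_pos_of_lt hc hcs (not_lt.1 h)
  linarith

/-! ### The maximum of the variance -/

/-- The derivative of the variance `4 s ^ 2 * callVar s`, divided by `8 s`. -/
def varSlope (s : ℝ) : ℝ := callVar s - s * stdCall s * (1 - stdTail s)

lemma hasDerivAt_callVar (s : ℝ) :
    HasDerivAt callVar (-(2 * stdCall s * (1 - stdTail s))) s :=
  ((hasDerivAt_stdSqCall s).sub ((hasDerivAt_stdCall s).pow 2)).congr_deriv (by simp; ring)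

lemma hasDerivAt_sq_mul_callVar (s : ℝ) :
    HasDerivAt (fun s => 4 * s ^ 2 * callVar s) (8 * s * varSlope s) s :=
  (((hasDerivAt_pow 2 s).const_mul 4).mul (hasDerivAt_callVar s)).congr_deriv
    (by simp [varSlope]; ring)

lemma varSlope_div_stdCall (s : ℝ) :
    varSlope s / stdCall s = stdSqCall s / stdCall s - stdCall s - s * (1 - stdTail s) := by
  have := (stdCall_pos s).ne'
  unfold varSlope callVar
  field_simp

lemma hasDerivAt_varSlope_div_stdCall (s : ℝ) :
    HasDerivAt (fun s => varSlope s / stdCall s)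
      (-3 + 2 * stdTail s - s * stdDensity s + stdTail s * stdSqCall s / stdCall s ^ 2) s := by
  have h := (((hasDerivAt_stdSqCall s).div (hasDerivAt_stdCall s) (stdCall_pos s).ne').sub
    (hasDerivAt_stdCall s)).sub ((hasDerivAt_id s).mul ((hasDerivAt_stdTail s).const_sub 1))
  have h2 : HasDerivAt (fun s => varSlope s / stdCall s) _ s :=
    h.congr_of_eventuallyEq (Eventually.of_forall varSlope_div_stdCall)
  refine h2.congr_deriv ?_
  have := (stdCall_pos s).ne'
  simp only [id_eq]
  field_simp
  ring

/-- Division by `stdCall` turns the slope of the variance into a monotone function. In its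
derivative the last quotient is at most 2 by log-concavity of `stdSqCall`, and 2 * `stdTail` < 1 for
positive arguments, so the constant -3 wins. -/
lemma strictAntiOn_varSlope_div_stdCall :
    StrictAntiOn (fun s => varSlope s / stdCall s) (Set.Ici 0) := by
  refine strictAntiOn_of_hasDerivWithinAt_neg (convex_Ici 0)
    (fun x _ => (hasDerivAt_varSlope_div_stdCall x).continuousAt.continuousWithinAt)
    (fun x _ => (hasDerivAt_varSlope_div_stdCall x).hasDerivWithinAt) ?_
  intro x hx
  rw [interior_Ici, Set.mem_Ioi] at hx
  have h1 : stdTail x * stdSqCall x / stdCall x ^ 2 ≤ 2 := by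
    rw [div_le_iff₀ (pow_pos (stdCall_pos x) 2)]
    exact stdTail_mul_stdSqCall_le x
  have h2 : stdTail x < 1 / 2 := stdTail_zero ▸ strictAnti_stdTail hx
  have h3 := mul_pos hx (stdDensity_pos x)
  linarith

lemma varSlope_pos_of_lt {s c : ℝ} (hs : 0 ≤ s) (hsc : s < c) (hc : 0 ≤ varSlope c) :
    0 < varSlope s := by
  have h := strictAntiOn_varSlope_div_stdCall (Set.mem_Ici.2 hs)
    (Set.mem_Ici.2 (hs.trans hsc.le)) hsc
  have h1 : 0 ≤ varSlope c / stdCall c := div_nonneg hc (stdCall_pos c).le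
  have h2 : 0 < varSlope s / stdCall s := h1.trans_lt h
  have h3 := mul_pos h2 (stdCall_pos s)
  rwa [div_mul_cancel₀ _ (stdCall_pos s).ne'] at h3

lemma varSlope_neg_of_lt {s c : ℝ} (hc : 0 ≤ c) (hcs : c < s) (h0 : varSlope c ≤ 0) :
    varSlope s < 0 := by
  by_contra h
  have := varSlope_pos_of_lt hc hcs (not_lt.1 h)
  linarith

/-- Lets the slope at one numerical point control the growth of the variance up to its maximum. -/
lemma varSlope_le_of_le {s c : ℝ} (hc : 0 ≤ c) (hcs : c ≤ s) (h0 : 0 ≤ varSlope c) :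
    varSlope s ≤ varSlope c := by
  have h := strictAntiOn_varSlope_div_stdCall.antitoneOn (Set.mem_Ici.2 hc)
    (Set.mem_Ici.2 (hc.trans hcs)) hcs
  have h1 := strictAnti_stdCall.antitone hcs
  have h2 := stdCall_pos s
  rw [div_le_iff₀ h2] at h
  refine h.trans ?_
  calc varSlope c / stdCall c * stdCall s ≤ varSlope c / stdCall c * stdCall c := by
        have := div_nonneg h0 (stdCall_pos c).le
        gcongr
    _ = varSlope c := div_mul_cancel₀ _ (stdCall_pos c).ne'

/-! ### Numerical values of the density and the tail -/

lemma inv_sqrt_two_pi_bounds :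
    0.398942 < (√(2 * Real.pi))⁻¹ ∧ (√(2 * Real.pi))⁻¹ < 0.398943 := by
  have h0 : 0 < √(2 * Real.pi) := by positivity
  have h1 := Real.pi_gt_d6
  have h2 := Real.pi_lt_d6
  constructor
  · rw [lt_inv_comm₀ (by norm_num) h0, Real.sqrt_lt' (by norm_num)]
    norm_num at *; linarith
  · rw [inv_lt_comm₀ h0 (by norm_num), Real.lt_sqrt (by norm_num)]
    norm_num at *; linarith

/-- Six Taylor terms of exp at -x²/2; the remainder constant is 7/(6! * 6), divided by the 2⁶ coming
from the sixth power of x²/2. -/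
lemma abs_exp_neg_sq_sub_le {x : ℝ} (hx : x ∈ Set.Icc (0 : ℝ) 1) :
    |Real.exp (-x ^ 2 / 2) - (1 - x ^ 2 / 2 + x ^ 4 / 8 - x ^ 6 / 48 + x ^ 8 / 384 - x ^ 10 / 3840)|
      ≤ 7 / 276480 * x ^ 12 := by
  have h := Real.exp_bound (x := -x ^ 2 / 2) (n := 6)
    (by rw [abs_le]; constructor <;> nlinarith [hx.1, hx.2]) (by norm_num)
  simp only [Finset.sum_range_succ, Finset.sum_range_zero, Nat.factorial] at h
  have h2 : |(-x ^ 2 / 2)| ^ 6 = x ^ 12 / 64 := by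
    rw [show -x ^ 2 / 2 = -(x ^ 2 / 2) by ring, abs_neg, abs_of_nonneg (by positivity)]; ring
  rw [h2] at h
  norm_num at h
  convert h using 1
  · congr 1; ring
  · ring

lemma abs_integral_exp_neg_sq_sub_le {s : ℝ} (hs : s ∈ Set.Icc (0 : ℝ) 1) :
    |(∫ x in (0 : ℝ)..s, Real.exp (-x ^ 2 / 2)) -
      (s - s ^ 3 / 6 + s ^ 5 / 40 - s ^ 7 / 336 + s ^ 9 / 3456 - s ^ 11 / 42240)|
      ≤ 7 / 3594240 * s ^ 13 := by
  set p : ℝ → ℝ := fun x =>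
    1 - x ^ 2 / 2 + x ^ 4 / 8 - x ^ 6 / 48 + x ^ 8 / 384 - x ^ 10 / 3840 with hp
  have hpc : Continuous p := by fun_prop
  have hec : Continuous fun x : ℝ => Real.exp (-x ^ 2 / 2) := by fun_prop
  have hpint : ∫ x in (0 : ℝ)..s, p x =
      s - s ^ 3 / 6 + s ^ 5 / 40 - s ^ 7 / 336 + s ^ 9 / 3456 - s ^ 11 / 42240 := by
    have hd : ∀ x ∈ Set.uIcc 0 s, HasDerivAt (fun s : ℝ =>
        s - s ^ 3 / 6 + s ^ 5 / 40 - s ^ 7 / 336 + s ^ 9 / 3456 - s ^ 11 / 42240) (p x) x := by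
      intro x _
      exact ((((((hasDerivAt_id x).sub ((hasDerivAt_pow 3 x).div_const 6)).add
        ((hasDerivAt_pow 5 x).div_const 40)).sub ((hasDerivAt_pow 7 x).div_const 336)).add
        ((hasDerivAt_pow 9 x).div_const 3456)).sub
        ((hasDerivAt_pow 11 x).div_const 42240)).congr_deriv (by simp [hp]; ring)
    rw [intervalIntegral.integral_eq_sub_of_hasDerivAt hd (hpc.intervalIntegrable _ _)]
    simp
  have hbint : ∫ x in (0 : ℝ)..s, 7 / 276480 * x ^ 12 = 7 / 3594240 * s ^ 13 := by
    rw [intervalIntegral.integral_const_mul, integral_pow]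
    norm_num; ring
  rw [← hpint, ← hbint, ← intervalIntegral.integral_sub (hec.intervalIntegrable _ _)
    (hpc.intervalIntegrable _ _), ← Real.norm_eq_abs]
  refine intervalIntegral.norm_integral_le_of_norm_le hs.1 (Eventually.of_forall fun x hx => ?_)
    (Continuous.intervalIntegrable (by fun_prop) _ _)
  exact abs_exp_neg_sq_sub_le ⟨hx.1.le, hx.2.trans hs.2⟩

lemma stdDensity_bounds {s l r : ℝ} (hs : s ∈ Set.Icc (0 : ℝ) 1) (hl0 : 0 ≤ l)
    (hl : l ≤ 1 - s ^ 2 / 2 + s ^ 4 / 8 - s ^ 6 / 48 + s ^ 8 / 384 - s ^ 10 / 3840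
      - 7 / 276480 * s ^ 12)
    (hr : 1 - s ^ 2 / 2 + s ^ 4 / 8 - s ^ 6 / 48 + s ^ 8 / 384 - s ^ 10 / 3840
      + 7 / 276480 * s ^ 12 ≤ r) :
    0.398942 * l ≤ stdDensity s ∧ stdDensity s ≤ 0.398943 * r := by
  have h := abs_le.1 (abs_exp_neg_sq_sub_le hs)
  obtain ⟨h1, h2⟩ := inv_sqrt_two_pi_bounds
  unfold stdDensity
  have h3 := Real.exp_pos (-s ^ 2 / 2)
  constructor
  · exact mul_le_mul h1.le (by linarith [h.1]) hl0 (by linarith)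
  · exact mul_le_mul h2.le (by linarith [h.2]) h3.le (by norm_num)

lemma stdTail_bounds {s l r : ℝ} (hs : s ∈ Set.Icc (0 : ℝ) 1) (hl0 : 0 ≤ l)
    (hl : l ≤ s - s ^ 3 / 6 + s ^ 5 / 40 - s ^ 7 / 336 + s ^ 9 / 3456 - s ^ 11 / 42240
      - 7 / 3594240 * s ^ 13)
    (hr : s - s ^ 3 / 6 + s ^ 5 / 40 - s ^ 7 / 336 + s ^ 9 / 3456 - s ^ 11 / 42240
      + 7 / 3594240 * s ^ 13 ≤ r) :
    1 / 2 - 0.398943 * r ≤ stdTail s ∧ stdTail s ≤ 1 / 2 - 0.398942 * l := by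
  have h := abs_le.1 (abs_integral_exp_neg_sq_sub_le hs)
  obtain ⟨h1, h2⟩ := inv_sqrt_two_pi_bounds
  rw [stdTail_eq]
  unfold stdDensity
  rw [intervalIntegral.integral_const_mul]
  set I := ∫ x in (0 : ℝ)..s, Real.exp (-x ^ 2 / 2)
  have h3 : l ≤ I := by linarith [h.1]
  have h4 : I ≤ r := by linarith [h.2]
  have h5 : (√(2 * Real.pi))⁻¹ * I ≤ 0.398943 * r :=
    mul_le_mul h2.le h4 (hl0.trans h3) (by norm_num)
  have h6 : 0.398942 * l ≤ (√(2 * Real.pi))⁻¹ * I :=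
    mul_le_mul h1.le h3 hl0 (by linarith)
  constructor <;> linarith

lemma stdDensity_061 : 0.3312143 ≤ stdDensity 0.61 ∧ stdDensity 0.61 ≤ 0.3312153 := by
  have := stdDensity_bounds (s := 0.61) (l := 0.8302319) (r := 0.8302321)
    (by norm_num) (by norm_num) (by norm_num) (by norm_num)
  constructor <;> linarith [this.1, this.2]

lemma stdTail_061 : 0.2709304 ≤ stdTail 0.61 ∧ stdTail 0.61 ≤ 0.2709311 := by
  have := stdTail_bounds (s := 0.61) (l := 0.574191) (r := 0.5741911)
    (by norm_num) (by norm_num) (by norm_num) (by norm_num)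
  constructor <;> linarith [this.1, this.2]

lemma stdDensity_062 : 0.3291836 ≤ stdDensity 0.62 ∧ stdDensity 0.62 ≤ 0.3291846 := by
  have := stdDensity_bounds (s := 0.62) (l := 0.8251416) (r := 0.8251419)
    (by norm_num) (by norm_num) (by norm_num) (by norm_num)
  constructor <;> linarith [this.1, this.2]

lemma stdTail_062 : 0.2676284 ≤ stdTail 0.62 ∧ stdTail 0.62 ≤ 0.2676291 := by
  have := stdTail_bounds (s := 0.62) (l := 0.5824679) (r := 0.582468)
    (by norm_num) (by norm_num) (by norm_num) (by norm_num)
  constructor <;> linarith [this.1, this.2]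

lemma stdDensity_098 : 0.246795 ≤ stdDensity 0.98 ∧ stdDensity 0.98 ≤ 0.2468116 := by
  have := stdDensity_bounds (s := 0.98) (l := 0.6186238) (r := 0.6186636)
    (by norm_num) (by norm_num) (by norm_num) (by norm_num)
  constructor <;> linarith [this.1, this.2]

lemma stdTail_098 : 0.1635423 ≤ stdTail 0.98 ∧ stdTail 0.98 ≤ 0.1635445 := by
  have := stdTail_bounds (s := 0.98) (l := 0.8433697) (r := 0.8433728)
    (by norm_num) (by norm_num) (by norm_num) (by norm_num)
  constructor <;> linarith [this.1, this.2]

lemma stdDensity_one : 0.2419523 ≤ stdDensity 1 ∧ stdDensity 1 ≤ 0.2419733 := by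
  have := stdDensity_bounds (s := 1) (l := 0.606485) (r := 0.6065358)
    (by norm_num) (by norm_num) (by norm_num) (by norm_num)
  constructor <;> linarith [this.1, this.2]

lemma stdTail_one : 0.1586544 ≤ stdTail 1 ∧ stdTail 1 ≤ 0.158657 := by
  have := stdTail_bounds (s := 1) (l := 0.8556208) (r := 0.8556248)
    (by norm_num) (by norm_num) (by norm_num) (by norm_num)
  constructor <;> linarith [this.1, this.2]

/-! ### Locating the maxima -/

lemma exists_critical_callMean :
    ∃ s ∈ Set.Ioo (0.61 : ℝ) 0.62, stdCall s - s * stdTail s = 0 := by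
  have h61 : 0 < stdCall 0.61 - 0.61 * stdTail 0.61 := by
    unfold stdCall
    linarith [stdDensity_061.1, stdTail_061.2]
  have h62 : stdCall 0.62 - 0.62 * stdTail 0.62 < 0 := by
    unfold stdCall
    linarith [stdDensity_062.2, stdTail_062.1]
  have hc : ContinuousOn (fun s => stdCall s - s * stdTail s) (Set.Icc 0.61 0.62) :=
    (continuous_stdCall.sub (continuous_id.mul continuous_stdTail)).continuousOn
  obtain ⟨s, hs, hs0⟩ := intermediate_value_Ioo' (by norm_num) hc (show (0 : ℝ) ∈ _ from ⟨h62, h61⟩)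
  exact ⟨s, hs, hs0⟩

lemma exists_critical_callVar : ∃ s ∈ Set.Ioo (0.98 : ℝ) 1, varSlope s = 0 := by
  have h98 : 0 < varSlope 0.98 := by
    unfold varSlope callVar stdSqCall stdCall
    obtain ⟨h1, h2⟩ := stdDensity_098
    obtain ⟨h3, h4⟩ := stdTail_098
    nlinarith
  have h1 : varSlope 1 < 0 := by
    unfold varSlope callVar stdSqCall stdCall
    obtain ⟨h1, h2⟩ := stdDensity_one
    obtain ⟨h3, h4⟩ := stdTail_one
    nlinarith
  have hc : ContinuousOn varSlope (Set.Icc 0.98 1) := by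
    refine Continuous.continuousOn ?_
    unfold varSlope callVar
    exact (continuous_stdSqCall.sub (continuous_stdCall.pow 2)).sub
      ((continuous_id.mul continuous_stdCall).mul (continuous_const.sub continuous_stdTail))
  obtain ⟨s, hs, hs0⟩ := intermediate_value_Ioo' (by norm_num) hc (show (0 : ℝ) ∈ _ from ⟨h1, h98⟩)
  exact ⟨s, hs, hs0⟩

/-- Half the scale at which the mean of the censored contribution is maximal. -/
def meanArgmax : ℝ := exists_critical_callMean.choose

lemma meanArgmax_mem : meanArgmax ∈ Set.Ioo (0.61 : ℝ) 0.62 :=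
  exists_critical_callMean.choose_spec.1

lemma meanArgmax_critical : stdCall meanArgmax - meanArgmax * stdTail meanArgmax = 0 :=
  exists_critical_callMean.choose_spec.2

/-- Half the scale at which the variance of the censored contribution is maximal. -/
def varArgmax : ℝ := exists_critical_callVar.choose

lemma varArgmax_mem : varArgmax ∈ Set.Ioo (0.98 : ℝ) 1 :=
  exists_critical_callVar.choose_spec.1

lemma varArgmax_critical : varSlope varArgmax = 0 :=
  exists_critical_callVar.choose_spec.2

lemma continuous_callMean : Continuous callMean :=
  continuous_iff_continuousAt.2 fun s => (hasDerivAt_callMean s).continuousAt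

lemma strictMonoOn_callMean : StrictMonoOn callMean (Set.Icc 0 meanArgmax) := by
  refine strictMonoOn_of_hasDerivWithinAt_pos (convex_Icc _ _) continuous_callMean.continuousOn
    (fun x _ => (hasDerivAt_callMean x).hasDerivWithinAt) fun x hx => ?_
  rw [interior_Icc] at hx
  have := stdCall_sub_pos_of_lt hx.1.le hx.2 meanArgmax_critical.ge
  linarith

lemma strictAntiOn_callMean : StrictAntiOn callMean (Set.Ici meanArgmax) := by
  refine strictAntiOn_of_hasDerivWithinAt_neg (convex_Ici _) continuous_callMean.continuousOn
    (fun x _ => (hasDerivAt_callMean x).hasDerivWithinAt) fun x hx => ?_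
  rw [interior_Ici] at hx
  have := stdCall_sub_neg_of_lt (by linarith [meanArgmax_mem.1]) hx meanArgmax_critical.le
  linarith

lemma callMean_le {s : ℝ} (hs : 0 ≤ s) : callMean s ≤ callMean meanArgmax := by
  have h := meanArgmax_mem.1
  rcases le_total s meanArgmax with h1 | h1
  · exact strictMonoOn_callMean.monotoneOn ⟨hs, h1⟩ ⟨by linarith, le_rfl⟩ h1
  · exact strictAntiOn_callMean.antitoneOn (Set.mem_Ici.2 le_rfl) h1 h1

lemma strictMonoOn_sq_mul_callVar :
    StrictMonoOn (fun s => 4 * s ^ 2 * callVar s) (Set.Icc 0 varArgmax) := by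
  refine strictMonoOn_of_hasDerivWithinAt_pos (convex_Icc _ _)
    (fun x _ => (hasDerivAt_sq_mul_callVar x).continuousAt.continuousWithinAt)
    (fun x _ => (hasDerivAt_sq_mul_callVar x).hasDerivWithinAt) fun x hx => ?_
  rw [interior_Icc] at hx
  have := varSlope_pos_of_lt hx.1.le hx.2 varArgmax_critical.ge
  have := hx.1
  positivity

lemma strictAntiOn_sq_mul_callVar :
    StrictAntiOn (fun s => 4 * s ^ 2 * callVar s) (Set.Ici varArgmax) := by
  refine strictAntiOn_of_hasDerivWithinAt_neg (convex_Ici _)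
    (fun x _ => (hasDerivAt_sq_mul_callVar x).continuousAt.continuousWithinAt)
    (fun x _ => (hasDerivAt_sq_mul_callVar x).hasDerivWithinAt) fun x hx => ?_
  rw [interior_Ici, Set.mem_Ioi] at hx
  have h := varArgmax_mem.1
  have := varSlope_neg_of_lt (by linarith) hx varArgmax_critical.le
  exact mul_neg_of_pos_of_neg (by linarith) this

lemma sq_mul_callVar_le {s : ℝ} (hs : 0 ≤ s) :
    4 * s ^ 2 * callVar s ≤ 4 * varArgmax ^ 2 * callVar varArgmax := by
  have h := varArgmax_mem.1
  rcases le_total s varArgmax with h1 | h1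
  · exact strictMonoOn_sq_mul_callVar.monotoneOn ⟨hs, h1⟩ ⟨by linarith, le_rfl⟩ h1
  · exact strictAntiOn_sq_mul_callVar.antitoneOn (Set.mem_Ici.2 le_rfl) h1 h1

/-- The source of all slack in the theorem: the scale with the largest mean lies strictly before the
one with the largest variance, on the interval where the variance increases. -/
lemma sq_mul_callVar_meanArgmax_lt :
    4 * meanArgmax ^ 2 * callVar meanArgmax < 4 * varArgmax ^ 2 * callVar varArgmax := by
  have h := varArgmax_mem.1
  obtain ⟨h1, h2⟩ := meanArgmax_mem
  exact strictMonoOn_sq_mul_callVar ⟨by linarith, by linarith⟩ ⟨by linarith, le_rfl⟩ (by linarith)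

/-- The maximum is at least the value at 0.61, and exceeds it by at most the slope there times 0.01,
since the slope decreases up to the critical point. -/
lemma callMean_meanArgmax_bounds : |callMean meanArgmax - 0.202| ≤ 0.0005 := by
  obtain ⟨h1, h2⟩ := meanArgmax_mem
  have hlow : callMean 0.61 ≤ callMean meanArgmax := callMean_le (by norm_num)
  have hd : ∀ x ∈ Set.Ioo (0.61 : ℝ) meanArgmax,
      2 * (stdCall x - x * stdTail x) ≤ 2 * (stdCall 0.61 - 0.61 * stdTail 0.61) := by
    intro x hx
    have h3 := strictMonoOn_mul_stdTail_div_stdCall (Set.mem_Ici.2 (by norm_num : (0 : ℝ) ≤ 0.61))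
      (Set.mem_Ici.2 (by linarith [hx.1] : (0 : ℝ) ≤ x)) hx.1
    have h4 := strictAnti_stdCall hx.1
    have h5 := stdCall_sub_pos_of_lt (by linarith [hx.1] : (0 : ℝ) ≤ x) hx.2 meanArgmax_critical.ge
    rw [stdCall_sub_eq] at h5
    have h6 := pos_of_mul_pos_right h5 (stdCall_pos x).le
    rw [stdCall_sub_eq, stdCall_sub_eq]
    simp only at h3
    nlinarith [stdCall_pos x, stdCall_pos 0.61]
  have hup : callMean meanArgmax - callMean 0.61 ≤
      2 * (stdCall 0.61 - 0.61 * stdTail 0.61) * (meanArgmax - 0.61) := by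
    refine Convex.image_sub_le_mul_sub_of_deriv_le (convex_Icc 0.61 meanArgmax)
      continuous_callMean.continuousOn
      (fun x _ => (hasDerivAt_callMean x).differentiableAt.differentiableWithinAt) ?_
      0.61 ⟨le_rfl, h1.le⟩ meanArgmax ⟨h1.le, le_rfl⟩ h1.le
    intro x hx
    rw [interior_Icc] at hx
    rw [(hasDerivAt_callMean x).deriv]
    exact hd x hx
  obtain ⟨h5, h6⟩ := stdDensity_061
  obtain ⟨h7, h8⟩ := stdTail_061
  unfold callMean at hlow hup ⊢
  have h9 : 2 * (stdCall 0.61 - 0.61 * stdTail 0.61) ≤ 0.00138 := by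
    unfold stdCall; linarith
  have h10 : 2 * (stdCall 0.61 - 0.61 * stdTail 0.61) * (meanArgmax - 0.61) ≤ 0.00138 * 0.01 :=
    mul_le_mul h9 (by linarith) (by linarith) (by norm_num)
  unfold stdCall at hlow hup h10 ⊢
  rw [abs_le]
  constructor <;> linarith

lemma sq_mul_callVar_varArgmax_bounds :
    0.5225 ^ 2 ≤ 4 * varArgmax ^ 2 * callVar varArgmax ∧
      4 * varArgmax ^ 2 * callVar varArgmax ≤ 0.5235 ^ 2 := by
  obtain ⟨h1, h2⟩ := varArgmax_mem
  have hlow : 4 * 0.98 ^ 2 * callVar 0.98 ≤ 4 * varArgmax ^ 2 * callVar varArgmax :=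
    sq_mul_callVar_le (by norm_num)
  have h0 : 0 < varSlope 0.98 := varSlope_pos_of_lt (by norm_num) h1 varArgmax_critical.ge
  have hup : 4 * varArgmax ^ 2 * callVar varArgmax - 4 * 0.98 ^ 2 * callVar 0.98 ≤
      8 * varSlope 0.98 * (varArgmax - 0.98) := by
    refine Convex.image_sub_le_mul_sub_of_deriv_le (convex_Icc 0.98 varArgmax)
      (f := fun s => 4 * s ^ 2 * callVar s)
      (fun x _ => (hasDerivAt_sq_mul_callVar x).continuousAt.continuousWithinAt)
      (fun x _ => (hasDerivAt_sq_mul_callVar x).differentiableAt.differentiableWithinAt) ?_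
      0.98 ⟨le_rfl, h1.le⟩ varArgmax ⟨h1.le, le_rfl⟩ h1.le
    intro x hx
    rw [interior_Icc] at hx
    rw [(hasDerivAt_sq_mul_callVar x).deriv]
    have h3 := varSlope_le_of_le (by norm_num) hx.1.le h0.le
    have h4 := varSlope_pos_of_lt (by linarith [hx.1] : (0 : ℝ) ≤ x) hx.2 varArgmax_critical.ge
    -- The derivative is 8 * x * `varSlope x`, and x < `varArgmax` < 1.
    nlinarith [hx.1, hx.2]
  obtain ⟨h5, h6⟩ := stdDensity_098
  obtain ⟨h7, h8⟩ := stdTail_098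
  have h9 : varSlope 0.98 ≤ 0.0006 := by
    unfold varSlope callVar stdSqCall stdCall
    nlinarith
  have h10 : 8 * varSlope 0.98 * (varArgmax - 0.98) ≤ 8 * 0.0006 * 0.02 :=
    mul_le_mul (by linarith) (by linarith) (by linarith) (by norm_num)
  have h11 : 0.2735 ≤ 4 * 0.98 ^ 2 * callVar 0.98 := by
    unfold callVar stdSqCall stdCall
    nlinarith
  have h12 : 4 * 0.98 ^ 2 * callVar 0.98 ≤ 0.27385 := by
    unfold callVar stdSqCall stdCall
    nlinarith
  constructor <;> norm_num at * <;> linarith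

/-! ### A quadratic gap for the mean -/

/-- The left side is half the second derivative of `callMean`. It is increasing on [0, 1], so its
value at 1 bounds it, and `callMean` is strongly concave there. -/
lemma mul_stdDensity_sub_le {s : ℝ} (hs : s ∈ Set.Icc (0 : ℝ) 1) :
    s * stdDensity s - 2 * stdTail s ≤ -0.07 := by
  have hd : ∀ x, HasDerivAt (fun s => s * stdDensity s - 2 * stdTail s)
      ((3 - x ^ 2) * stdDensity x) x := fun x =>
    (((hasDerivAt_id x).mul (hasDerivAt_stdDensity x)).sub
      ((hasDerivAt_stdTail x).const_mul 2)).congr_deriv (by simp; ring)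
  have hmono : MonotoneOn (fun s => s * stdDensity s - 2 * stdTail s) (Set.Icc 0 1) := by
    refine monotoneOn_of_hasDerivWithinAt_nonneg (convex_Icc _ _)
      (fun x _ => (hd x).continuousAt.continuousWithinAt)
      (fun x _ => (hd x).hasDerivWithinAt) fun x hx => ?_
    rw [interior_Icc] at hx
    have := stdDensity_pos x
    have : x ^ 2 ≤ 1 := by nlinarith [hx.1, hx.2]
    exact mul_nonneg (by linarith) (by linarith)
  have h := hmono hs ⟨zero_le_one, le_rfl⟩ hs.2
  simp only at h
  linarith [stdDensity_one.2, stdTail_one.1]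

lemma antitoneOn_stdCall_sub_add :
    AntitoneOn (fun s => stdCall s - s * stdTail s + 0.07 * (s - meanArgmax)) (Set.Icc 0 1) := by
  have hd : ∀ x, HasDerivAt (fun s => stdCall s - s * stdTail s + 0.07 * (s - meanArgmax))
      (x * stdDensity x - 2 * stdTail x + 0.07) x := fun x =>
    ((hasDerivAt_stdCall_sub x).add
      (((hasDerivAt_id x).sub_const meanArgmax).const_mul 0.07)).congr_deriv (by simp)
  refine antitoneOn_of_hasDerivWithinAt_nonpos (convex_Icc _ _)
    (fun x _ => (hd x).continuousAt.continuousWithinAt)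
    (fun x _ => (hd x).hasDerivWithinAt) fun x hx => ?_
  have := mul_stdDensity_sub_le (interior_subset hx)
  linarith

lemma callMean_le_sub_sq {s : ℝ} (hs : s ∈ Set.Icc (0 : ℝ) 1) :
    callMean s ≤ callMean meanArgmax - 0.07 * (s - meanArgmax) ^ 2 := by
  obtain ⟨h1, h2⟩ := meanArgmax_mem
  have hd : ∀ x, HasDerivAt (fun s => callMean s + 0.07 * (s - meanArgmax) ^ 2)
      (2 * (stdCall x - x * stdTail x + 0.07 * (x - meanArgmax))) x := fun x =>
    ((hasDerivAt_callMean x).add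
      ((((hasDerivAt_id x).sub_const meanArgmax).pow 2).const_mul 0.07)).congr_deriv
      (by simp; ring)
  have hmem : meanArgmax ∈ Set.Icc (0 : ℝ) 1 := ⟨by linarith, by linarith⟩
  have hcrit := meanArgmax_critical
  have key : callMean s + 0.07 * (s - meanArgmax) ^ 2 ≤
      callMean meanArgmax + 0.07 * (meanArgmax - meanArgmax) ^ 2 := by
    rcases le_total s meanArgmax with h | h
    · have hm : MonotoneOn (fun s => callMean s + 0.07 * (s - meanArgmax) ^ 2)
          (Set.Icc 0 meanArgmax) := by
        refine monotoneOn_of_hasDerivWithinAt_nonneg (convex_Icc _ _)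
          (fun x _ => (hd x).continuousAt.continuousWithinAt)
          (fun x _ => (hd x).hasDerivWithinAt) fun x hx => ?_
        rw [interior_Icc] at hx
        have := antitoneOn_stdCall_sub_add ⟨hx.1.le, by linarith [hx.2]⟩ hmem hx.2.le
        simp only at this
        linarith
      exact hm ⟨hs.1, h⟩ ⟨by linarith, le_rfl⟩ h
    · have hm : AntitoneOn (fun s => callMean s + 0.07 * (s - meanArgmax) ^ 2)
          (Set.Icc meanArgmax 1) := by
        refine antitoneOn_of_hasDerivWithinAt_nonpos (convex_Icc _ _)
          (fun x _ => (hd x).continuousAt.continuousWithinAt)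
          (fun x _ => (hd x).hasDerivWithinAt) fun x hx => ?_
        rw [interior_Icc] at hx
        have := antitoneOn_stdCall_sub_add hmem ⟨by linarith [hx.1], hx.2.le⟩ hx.1.le
        simp only at this
        linarith
      exact hm ⟨le_rfl, by linarith⟩ ⟨h, hs.2⟩ h
  simp only [sub_self, ne_eq, OfNat.ofNat_ne_zero, not_false_eq_true, zero_pow, mul_zero,
    add_zero] at key
  linarith

/-- The scale at which the mean of the censored contribution is maximal. -/
def optScale : ℝ := 2 * meanArgmax

lemma optScale_pos : 0 < optScale := by
  have := meanArgmax_mem.1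
  unfold optScale; linarith

/-- The maximal mean of a censored contribution. -/
def maxMean : ℝ := callMean meanArgmax

/-- For t ≤ 2 strong concavity gives a gap of 0.07/4 times the squared distance to `optScale`. For t
≥ 2 the mean is decreasing, and the gap already reached at t = 2 exceeds 0.002. -/
lemma callMean_half_le {t : ℝ} (ht : 0 ≤ t) :
    callMean (t / 2) ≤ maxMean - 0.002 * min ((t - optScale) ^ 2) 1 := by
  obtain ⟨h1, h2⟩ := meanArgmax_mem
  have hmin1 := min_le_left ((t - optScale) ^ 2) 1
  have hmin2 := min_le_right ((t - optScale) ^ 2) 1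
  unfold maxMean
  rcases le_total (t / 2) 1 with h | h
  · have := callMean_le_sub_sq (s := t / 2) ⟨by linarith, h⟩
    have h3 : (t / 2 - meanArgmax) ^ 2 = (t - optScale) ^ 2 / 4 := by unfold optScale; ring
    have h4 := sq_nonneg (t - optScale)
    linarith
  · have h3 := strictAntiOn_callMean.antitoneOn (Set.mem_Ici.2 (by linarith : meanArgmax ≤ 1))
      (Set.mem_Ici.2 (by linarith : meanArgmax ≤ t / 2)) h
    have h4 := callMean_le_sub_sq (s := 1) ⟨by norm_num, le_rfl⟩
    nlinarith

/-! ### Exponential moments of the excess over the optimal scale -/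

lemma censoredContribution_nonneg (t g : ℝ) : 0 ≤ censoredContribution t g := le_max_right _ _

lemma censoredContribution_le_sq (t g : ℝ) : censoredContribution t g ≤ g ^ 2 / 2 :=
  max_le (by nlinarith [sq_nonneg (t - g)]) (by positivity)

/-- The contribution is |g|-Lipschitz in the scale: where it is positive, 0 < t < 2g, its derivative
g - t has absolute value below g. -/
lemma censoredContribution_le_add {t t' : ℝ} (ht : 0 ≤ t) (g : ℝ) :
    censoredContribution t g ≤ censoredContribution t' g + |t - t'| * |g| := by
  have hnn := censoredContribution_nonneg t' g
  have hab : 0 ≤ |t - t'| * |g| := by positivity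
  refine max_le ?_ (by linarith)
  rcases le_or_gt (t * g - t ^ 2 / 2) 0 with h | h
  · linarith
  have htpos : 0 < t := lt_of_le_of_ne ht (by rintro rfl; simp at h)
  have hg : t < 2 * g := by nlinarith
  rw [abs_of_pos (by linarith : 0 < g)]
  rcases le_or_gt t t' with htt | htt
  · rw [abs_of_nonpos (by linarith)]
    rcases le_or_gt t' (2 * g) with h' | h'
    · have : t' * g - t' ^ 2 / 2 ≤ censoredContribution t' g := le_max_left _ _
      nlinarith
    · nlinarith
  · rw [abs_of_pos (by linarith)]
    have : t' * g - t' ^ 2 / 2 ≤ censoredContribution t' g := le_max_left _ _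
    rcases le_or_gt (-(2 * g)) t' with h' | h'
    · nlinarith
    · nlinarith

/-- The excess of a censored contribution over the one at the optimal scale. -/
def excess (t g : ℝ) : ℝ := censoredContribution t g - censoredContribution optScale g

lemma continuous_excess (t : ℝ) : Continuous (excess t) :=
  (continuous_censoredContribution t).sub (continuous_censoredContribution optScale)

lemma abs_excess_le_sq (t g : ℝ) : |excess t g| ≤ g ^ 2 / 2 := by
  have h1 := censoredContribution_le_sq t g
  have h2 := censoredContribution_le_sq optScale g
  have h3 := censoredContribution_nonneg t g
  have h4 := censoredContribution_nonneg optScale g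
  unfold excess
  rw [abs_le]; constructor <;> linarith

lemma abs_excess_le {t : ℝ} (ht : 0 ≤ t) (g : ℝ) : |excess t g| ≤ |t - optScale| * |g| := by
  have h1 := censoredContribution_le_add (t' := optScale) ht g
  have h2 := censoredContribution_le_add (t' := t) optScale_pos.le g
  rw [abs_sub_comm optScale t] at h2
  unfold excess
  rw [abs_le]; constructor <;> linarith

lemma exp_le_one_add_add_sq_mul (x : ℝ) : Real.exp x ≤ 1 + x + x ^ 2 * Real.exp |x| := by
  have h1 : Real.exp x - 1 - x ≤ x * (Real.exp x - 1) := by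
    have h2 := Real.add_one_le_exp (-x)
    have h3 := Real.exp_pos x
    have h4 : Real.exp x * Real.exp (-x) = 1 := by rw [← Real.exp_add]; simp
    nlinarith
  rcases le_total 0 x with h | h
  · rw [abs_of_nonneg h]
    have h2 : Real.exp x - 1 ≤ x * Real.exp x := by
      have h2 := Real.add_one_le_exp (-x)
      have h3 := Real.exp_pos x
      have h4 : Real.exp x * Real.exp (-x) = 1 := by rw [← Real.exp_add]; simp
      nlinarith
    nlinarith
  · have h2 := Real.add_one_le_exp x
    have h3 : 1 ≤ Real.exp |x| := Real.one_le_exp (abs_nonneg x)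
    nlinarith [sq_nonneg x]

lemma integrable_exp_sq_div_four :
    Integrable (fun g : ℝ => Real.exp (g ^ 2 / 4)) (gaussianReal 0 1) := by
  rw [gaussianReal_of_var_ne_zero _ one_ne_zero]
  rw [integrable_withDensity_iff_integrable_smul' (measurable_gaussianPDF 0 1)
    (Eventually.of_forall fun x => gaussianPDF_lt_top)]
  simp_rw [toReal_gaussianPDF, ← stdDensity_eq, smul_eq_mul, stdDensity, mul_assoc, ← Real.exp_add]
  have := (integrable_exp_neg_mul_sq (b := 1 / 4) (by norm_num)).const_mul (√(2 * Real.pi))⁻¹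
  refine this.congr (Eventually.of_forall fun x => ?_)
  simp only
  congr 2; ring

/-- The exponential moment `𝔼 exp (G ^ 2 / 4)`. -/
def expSqMoment : ℝ := ∫ g, Real.exp (g ^ 2 / 4) ∂(gaussianReal 0 1)

lemma expSqMoment_pos : 0 < expSqMoment := by
  have : (1 : ℝ) ≤ expSqMoment := by
    have h := integral_mono (μ := gaussianReal 0 1) (integrable_const 1)
      integrable_exp_sq_div_four (fun g => Real.one_le_exp (by positivity))
    simpa [expSqMoment] using h
  linarith

lemma censoredContribution_zero (g : ℝ) : censoredContribution 0 g = 0 := by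
  simp [censoredContribution]

lemma integral_censoredContribution {t : ℝ} (ht : 0 ≤ t) :
    ∫ g, censoredContribution t g ∂(gaussianReal 0 1) = callMean (t / 2) := by
  rcases ht.eq_or_lt with rfl | h
  · simp [censoredContribution_zero, callMean]
  · exact censoredMean_eq h

lemma integrable_censoredContribution {t : ℝ} (ht : 0 ≤ t) :
    Integrable (censoredContribution t) (gaussianReal 0 1) :=
  (memLp_censoredContribution ht).integrable (by norm_num)

/-- The factor `min ((t - optScale) ^ 2) 1` matches the gap of the mean in `callMean_half_le`. Near
`optScale` it comes from the Lipschitz bound, far away from |excess| ≤ g²/2; the remaining powers of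
g are absorbed by exp(g²/8). -/
lemma excess_sq_mul_exp_le {t : ℝ} (ht : 0 ≤ t) (g : ℝ) :
    excess t g ^ 2 * Real.exp (g ^ 2 / 8) ≤
      64 * min ((t - optScale) ^ 2) 1 * Real.exp (g ^ 2 / 4) := by
  have hE : Real.exp (g ^ 2 / 4) = Real.exp (g ^ 2 / 8) * Real.exp (g ^ 2 / 8) := by
    rw [← Real.exp_add]; congr 1; ring
  have h0 := Real.exp_pos (g ^ 2 / 8)
  suffices excess t g ^ 2 ≤ 64 * min ((t - optScale) ^ 2) 1 * Real.exp (g ^ 2 / 8) by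
    rw [hE]; nlinarith
  have h1 : g ^ 2 ≤ 8 * Real.exp (g ^ 2 / 8) := by linarith [Real.add_one_le_exp (g ^ 2 / 8)]
  rcases min_choice ((t - optScale) ^ 2) 1 with h | h <;> rw [h]
  · have h2 : excess t g ^ 2 ≤ (t - optScale) ^ 2 * g ^ 2 := by
      rw [← mul_pow, ← sq_abs (excess t g), ← sq_abs (_ * _), abs_mul]
      exact pow_le_pow_left₀ (abs_nonneg _) (abs_excess_le ht g) 2
    nlinarith [sq_nonneg (t - optScale)]
  · have h2 : excess t g ^ 2 ≤ (g ^ 2 / 2) ^ 2 := by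
      rw [← sq_abs (excess t g)]
      exact pow_le_pow_left₀ (abs_nonneg _) (abs_excess_le_sq t g) 2
    have h3 : Real.exp (g ^ 2 / 8) = Real.exp (g ^ 2 / 16) ^ 2 := by
      rw [← Real.exp_nat_mul]; congr 1; push_cast; ring
    have h4 : g ^ 2 / 16 ≤ Real.exp (g ^ 2 / 16) := by
      linarith [Real.add_one_le_exp (g ^ 2 / 16)]
    have h5 : (g ^ 2 / 16) ^ 2 ≤ Real.exp (g ^ 2 / 16) ^ 2 :=
      pow_le_pow_left₀ (by positivity) h4 2
    rw [h3]; nlinarith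

lemma integrable_exp_mul_excess {r : ℝ} (hr : 0 ≤ r) (hr4 : r ≤ 1 / 4) (t : ℝ) :
    Integrable (fun g => Real.exp (r * excess t g)) (gaussianReal 0 1) := by
  refine integrable_exp_sq_div_four.mono'
    ((Real.continuous_exp.comp ((continuous_excess t).const_mul r)).aestronglyMeasurable)
    (Eventually.of_forall fun g => ?_)
  rw [Real.norm_eq_abs, Real.abs_exp, Real.exp_le_exp]
  have h1 := abs_excess_le_sq t g
  have h2 := le_abs_self (excess t g)
  nlinarith [sq_nonneg g]

/-- With m = min((t - optScale)², 1), the first-order term is at most -0.002rm and the second-order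
term at most 64r²m E exp(G²/4). Both are proportional to m, so one small r serves all scales,
including those arbitrarily close to `optScale`. -/
lemma exists_integral_exp_mul_excess_le_one :
    ∃ r : ℝ, 0 < r ∧ r ≤ 1 / 4 ∧
      ∀ t, 0 ≤ t → ∫ g, Real.exp (r * excess t g) ∂(gaussianReal 0 1) ≤ 1 := by
  have hK := expSqMoment_pos
  -- The bound 1/4 keeps r|excess| ≤ g²/8, so that the exponential in the remainder is integrable;
  -- the other bound balances the two terms.
  refine ⟨min (1 / 4) (0.002 / (64 * expSqMoment)), by positivity, min_le_left _ _, ?_⟩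
  set r := min (1 / 4) (0.002 / (64 * expSqMoment)) with hr
  have hr0 : 0 < r := by positivity
  have hr4 : r ≤ 1 / 4 := min_le_left _ _
  have hrK : r * (64 * expSqMoment) ≤ 0.002 := by
    rw [← le_div_iff₀ (by positivity)]; exact min_le_right _ _
  intro t ht
  set m := min ((t - optScale) ^ 2) 1 with hm
  have hm0 : 0 ≤ m := by positivity
  have hint1 : Integrable (excess t) (gaussianReal 0 1) :=
    (integrable_censoredContribution ht).sub (integrable_censoredContribution optScale_pos.le)
  have hpt : ∀ g, Real.exp (r * excess t g) ≤
      1 + r * excess t g + r ^ 2 * (64 * m) * Real.exp (g ^ 2 / 4) := by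
    intro g
    refine (exp_le_one_add_add_sq_mul _).trans ?_
    have h1 : Real.exp |r * excess t g| ≤ Real.exp (g ^ 2 / 8) := by
      rw [Real.exp_le_exp, abs_mul, abs_of_pos hr0]
      nlinarith [abs_excess_le_sq t g, sq_nonneg g]
    have h2 := excess_sq_mul_exp_le ht g
    have h3 : (r * excess t g) ^ 2 * Real.exp |r * excess t g| ≤
        (r * excess t g) ^ 2 * Real.exp (g ^ 2 / 8) := by gcongr
    have h4 : (r * excess t g) ^ 2 * Real.exp (g ^ 2 / 8) =
        r ^ 2 * (excess t g ^ 2 * Real.exp (g ^ 2 / 8)) := by ring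
    have h5 := mul_le_mul_of_nonneg_left h2 (sq_nonneg r)
    rw [← hm] at h5
    linarith
  have hmean : ∫ g, excess t g ∂(gaussianReal 0 1) ≤ -(0.002 * m) := by
    unfold excess
    rw [integral_sub (integrable_censoredContribution ht)
      (integrable_censoredContribution optScale_pos.le), integral_censoredContribution ht,
      integral_censoredContribution optScale_pos.le]
    have := callMean_half_le ht
    have h2 : callMean (optScale / 2) = maxMean := by unfold maxMean optScale; congr 1; ring
    rw [h2]; linarith
  calc ∫ g, Real.exp (r * excess t g) ∂(gaussianReal 0 1)
      ≤ ∫ g, (1 + r * excess t g + r ^ 2 * (64 * m) * Real.exp (g ^ 2 / 4))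
          ∂(gaussianReal 0 1) :=
        integral_mono (integrable_exp_mul_excess hr0.le hr4 t)
          (((integrable_const 1).add (hint1.const_mul r)).add
            (integrable_exp_sq_div_four.const_mul _)) hpt
    _ = 1 + r * ∫ g, excess t g ∂(gaussianReal 0 1) + r ^ 2 * (64 * m) * expSqMoment := by
        have h1 : Integrable (fun g => 1 + r * excess t g) (gaussianReal 0 1) :=
          (integrable_const 1).add (hint1.const_mul r)
        rw [integral_add h1
          (integrable_exp_sq_div_four.const_mul _), integral_add (integrable_const 1)
          (hint1.const_mul r), integral_const_mul, integral_const_mul]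
        simp [expSqMoment]
    _ ≤ 1 := by
        have h1 := mul_le_mul_of_nonneg_left hmean hr0.le
        have h2 := mul_le_mul_of_nonneg_left hrK (mul_nonneg hr0.le hm0)
        nlinarith

/-! ### The supremum over the scales -/

section Supremum

variable {ι : Type u} [Fintype ι]

/-- The configurations at which the sum of the censored contributions, with relative scales `a`,
may be large for some common scale: an extreme coordinate, a large excess over the optimal scale
at some point of a finite net, or a large sum at the optimal scale. -/
def exceedSet (a : ι → ℝ) (δ τ : ℝ) : Set (ι → ℝ) :=
  (⋃ x, {H | √(Fintype.card ι) ≤ |H x|}) ∪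
  ((⋃ x₀, ⋃ j ∈ Finset.range (2 * Fintype.card ι ^ 3 + 1),
    {H | δ * √(Fintype.card ι) ≤
      ∑ x, excess ((j : ℝ) / (Fintype.card ι : ℝ) ^ 2 / a x₀ * a x) (H x)}) ∪
  {H | maxMean * Fintype.card ι + τ * √(Fintype.card ι) ≤
    ∑ x, censoredContribution optScale (H x)})

/-- Closedness gives the upper bound for limiting probabilities in the portmanteau theorem. -/
lemma isClosed_exceedSet (a : ι → ℝ) (δ τ : ℝ) : IsClosed (exceedSet a δ τ) := by
  refine IsClosed.union (isClosed_iUnion_of_finite fun x => ?_) (IsClosed.union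
    (isClosed_iUnion_of_finite fun x₀ => (Finset.finite_toSet _).isClosed_biUnion fun j _ => ?_) ?_)
  · exact isClosed_le continuous_const (continuous_apply x).abs
  · exact isClosed_le continuous_const
      (continuous_finsetSum _ fun x _ => (continuous_excess _).comp (continuous_apply x))
  · exact isClosed_le continuous_const
      (continuous_finsetSum _ fun x _ =>
        (continuous_censoredContribution _).comp (continuous_apply x))

/-- Rounding Z down to the net costs at most 1 in total. No bounds on the scales are available, so
the net is laid out relative to the largest scale among the coordinates that can still contribute;
this is why `exceedSet` ranges over all base points x₀. -/
lemma sum_censoredContribution_le_of_notMem_exceedSet [Nonempty ι] {a : ι → ℝ}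
    (ha : ∀ x, 0 < a x) {δ τ : ℝ} (hδ : 0 ≤ δ)
    {H : ι → ℝ} (hH : H ∉ exceedSet a δ τ) {Z : ℝ} (hZ : 0 ≤ Z) :
    ∑ x, censoredContribution (Z * a x) (H x) ≤
      maxMean * Fintype.card ι + (τ + δ) * √(Fintype.card ι) + 1 := by
  classical
  set M := Fintype.card ι with hM
  have hM1 : 1 ≤ M := Fintype.card_pos
  have hM1' : (1 : ℝ) ≤ M := by exact_mod_cast hM1
  have hsq : √(M : ℝ) * √(M : ℝ) = M := Real.mul_self_sqrt (by linarith)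
  have hs0 : 0 ≤ √(M : ℝ) := Real.sqrt_nonneg _
  have hs1 : √(M : ℝ) ≤ M := by nlinarith [Real.one_le_sqrt.2 hM1']
  simp only [exceedSet, Set.mem_union, Set.mem_iUnion, Set.mem_ofPred_eq, not_or, not_exists,
    not_le, Finset.mem_range] at hH
  obtain ⟨h1, h2, h3⟩ := hH
  -- the coordinates that contribute
  set A := Finset.univ.filter fun x => Z * a x < 2 * √(M : ℝ) with hA
  have hinactive : ∀ x, x ∉ A → censoredContribution (Z * a x) (H x) = 0 := by
    intro x hx
    have hx' : 2 * √(M : ℝ) ≤ Z * a x := by simpa [hA] using hx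
    refine max_eq_right ?_
    have h4 := (abs_lt.1 (h1 x)).2
    nlinarith
  rcases A.eq_empty_or_nonempty with hAe | hAne
  · rw [Finset.sum_eq_zero fun x _ => hinactive x (by simp [hAe])]
    have h4 : 0 ≤ ∑ x, censoredContribution optScale (H x) :=
      Finset.sum_nonneg fun x _ => censoredContribution_nonneg _ _
    rw [← hM] at h3
    linarith [mul_nonneg hδ hs0]
  obtain ⟨x₀, hx₀, hmax⟩ := A.exists_max_image a hAne
  have hx₀' : Z * a x₀ < 2 * √(M : ℝ) := by simpa [hA] using hx₀
  -- The mesh is M⁻² in the scale at x₀, hence at most M⁻² at every active coordinate. With |H x| ≤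
  -- M each coordinate loses at most 1/M. Since Z * a x₀ < 2√M ≤ 2M, the index is at most 2M³.
  set j := ⌊Z * a x₀ * (M : ℝ) ^ 2⌋₊ with hj
  have ht0 : 0 ≤ Z * a x₀ * (M : ℝ) ^ 2 := by have := ha x₀; positivity
  have hj1 : (j : ℝ) ≤ Z * a x₀ * (M : ℝ) ^ 2 := Nat.floor_le ht0
  have hj2 : Z * a x₀ * (M : ℝ) ^ 2 < j + 1 := Nat.lt_floor_add_one _
  have hjle : j < 2 * M ^ 3 + 1 := by
    rw [Nat.lt_succ_iff]
    have : (j : ℝ) ≤ ((2 * M ^ 3 : ℕ) : ℝ) := by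
      push_cast
      have : Z * a x₀ * (M : ℝ) ^ 2 ≤ 2 * M * (M : ℝ) ^ 2  :=
        mul_le_mul_of_nonneg_right (by linarith) (sq_nonneg _)
      nlinarith
    exact_mod_cast this
  have hMsq : (0 : ℝ) < (M : ℝ) ^ 2 := by positivity
  set Z' := (j : ℝ) / (M : ℝ) ^ 2 / a x₀ with hZ'
  have hZ'0 : 0 ≤ Z' := by have := ha x₀; positivity
  have hZ'Z : Z' * a x₀ ≤ Z * a x₀ := by
    rw [hZ', div_mul_cancel₀ _ (ha x₀).ne', div_le_iff₀ hMsq]; exact hj1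
  have hZZ' : Z * a x₀ ≤ Z' * a x₀ + 1 / (M : ℝ) ^ 2 := by
    rw [hZ', div_mul_cancel₀ _ (ha x₀).ne', ← add_div, le_div_iff₀ hMsq]; exact hj2.le
  have hle : Z' ≤ Z := le_of_mul_le_mul_right hZ'Z (ha x₀)
  have hstep : ∀ x, censoredContribution (Z * a x) (H x) ≤
      censoredContribution (Z' * a x) (H x) + 1 / M := by
    intro x
    by_cases hx : x ∈ A
    · have h4 := censoredContribution_le_add (t' := Z' * a x) (mul_nonneg hZ (ha x).le) (H x)
      have h5 : |Z * a x - Z' * a x| ≤ 1 / (M : ℝ) ^ 2 := by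
        rw [← sub_mul, abs_of_nonneg (mul_nonneg (by linarith) (ha x).le)]
        calc (Z - Z') * a x ≤ (Z - Z') * a x₀ :=
              mul_le_mul_of_nonneg_left (hmax x hx) (by linarith)
          _ ≤ _ := by linarith
      have h6 : |Z * a x - Z' * a x| * |H x| ≤ 1 / (M : ℝ) ^ 2 * M :=
        mul_le_mul h5 ((h1 x).le.trans hs1) (abs_nonneg _) (by positivity)
      have h7 : 1 / (M : ℝ) ^ 2 * M = 1 / M := by field_simp
      linarith
    · rw [hinactive x hx]
      have := censoredContribution_nonneg (Z' * a x) (H x)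
      positivity
  have hsum := Finset.sum_le_sum fun x (_ : x ∈ Finset.univ) => hstep x
  rw [Finset.sum_add_distrib, Finset.sum_const, Finset.card_univ, ← hM, nsmul_eq_mul,
    mul_one_div_cancel (by positivity)] at hsum
  have h8 := h2 x₀ j hjle
  simp only [excess, Finset.sum_sub_distrib] at h8
  linarith

/-- Chernoff's inequality: the moment generating function at r factorizes over the coordinates into
factors at most 1, whatever the scales. -/
lemma measure_pi_sum_excess_le {r : ℝ} (hr : 0 < r) (hr4 : r ≤ 1 / 4)
    (hmom : ∀ t, 0 ≤ t → ∫ g, Real.exp (r * excess t g) ∂(gaussianReal 0 1) ≤ 1)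
    {t : ι → ℝ} (ht : ∀ x, 0 ≤ t x) (y : ℝ) :
    (Measure.pi fun _ : ι => gaussianReal 0 1).real {H | y ≤ ∑ x, excess (t x) (H x)} ≤
      Real.exp (-r * y) := by
  have hprod : ∀ H : ι → ℝ, Real.exp (r * ∑ x, excess (t x) (H x)) =
      ∏ x, Real.exp (r * excess (t x) (H x)) := fun H => by
    rw [Finset.mul_sum, Real.exp_sum]
  have hint : Integrable (fun H : ι → ℝ => Real.exp (r * ∑ x, excess (t x) (H x)))
      (Measure.pi fun _ : ι => gaussianReal 0 1) := by
    simp_rw [hprod]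
    exact Integrable.fintype_prod (f := fun x g => Real.exp (r * excess (t x) g))
      fun x => integrable_exp_mul_excess hr.le hr4 (t x)
  refine (measure_ge_le_exp_mul_mgf y hr.le hint).trans ?_
  have : mgf (fun H : ι → ℝ => ∑ x, excess (t x) (H x))
      (Measure.pi fun _ : ι => gaussianReal 0 1) r ≤ 1 := by
    unfold mgf
    simp_rw [hprod]
    rw [integral_fintype_prod_eq_prod (f := fun x g => Real.exp (r * excess (t x) g))]
    exact Finset.prod_le_one (fun x _ => integral_nonneg fun g => (Real.exp_pos _).le)
      fun x _ => hmom _ (ht x)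
  nlinarith [Real.exp_pos (-r * y)]

lemma gaussianReal_le_abs_le (y : ℝ) (hy : 0 ≤ y) :
    (gaussianReal 0 1).real {g | y ≤ |g|} ≤ expSqMoment * Real.exp (-(y ^ 2 / 4)) := by
  have h := mul_meas_ge_le_integral_of_nonneg (μ := gaussianReal 0 1)
    (Eventually.of_forall fun g => (Real.exp_pos (g ^ 2 / 4)).le) integrable_exp_sq_div_four
    (Real.exp (y ^ 2 / 4))
  have hsub : {g : ℝ | y ≤ |g|} ⊆ {g | Real.exp (y ^ 2 / 4) ≤ Real.exp (g ^ 2 / 4)} := by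
    intro g hg
    have h2 : y ^ 2 ≤ g ^ 2 := by
      rw [← sq_abs g]; exact pow_le_pow_left₀ hy hg 2
    exact Real.exp_le_exp.2 (by linarith)
  have h2 := (mul_le_mul_of_nonneg_left (measureReal_mono (μ := gaussianReal 0 1) hsub)
    (Real.exp_pos (y ^ 2 / 4)).le).trans h
  rw [Real.exp_neg, ← div_eq_mul_inv, le_div_iff₀ (Real.exp_pos _), mul_comm]
  exact h2

lemma measure_pi_exceedSet_le {r : ℝ} (hr : 0 < r) (hr4 : r ≤ 1 / 4)
    (hmom : ∀ t, 0 ≤ t → ∫ g, Real.exp (r * excess t g) ∂(gaussianReal 0 1) ≤ 1)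
    {a : ι → ℝ} (ha : ∀ x, 0 < a x) (δ τ : ℝ) :
    (Measure.pi fun _ : ι => gaussianReal 0 1).real (exceedSet a δ τ) ≤
      Fintype.card ι * (expSqMoment * Real.exp (-(Fintype.card ι / 4))) +
      Fintype.card ι * (2 * Fintype.card ι ^ 3 + 1) * Real.exp (-r * (δ * √(Fintype.card ι))) +
      (Measure.pi fun _ : ι => gaussianReal 0 1).real
        {H | maxMean * Fintype.card ι + τ * √(Fintype.card ι) ≤
          ∑ x, censoredContribution optScale (H x)} := by
  set P := Measure.pi fun _ : ι => gaussianReal 0 1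
  unfold exceedSet
  refine (measureReal_union_le _ _).trans ?_
  rw [add_assoc]
  refine add_le_add ?_ ((measureReal_union_le _ _).trans (add_le_add ?_ le_rfl))
  · refine (measureReal_iUnion_fintype_le _).trans ?_
    have : ∀ x : ι, P.real {H | √(Fintype.card ι) ≤ |H x|} ≤
        expSqMoment * Real.exp (-(Fintype.card ι / 4)) := by
      intro x
      have h := gaussianReal_le_abs_le (√(Fintype.card ι)) (Real.sqrt_nonneg _)
      rw [Real.sq_sqrt (Nat.cast_nonneg _)] at h
      have hmp := measurePreserving_eval (fun _ : ι => gaussianReal 0 1) x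
      have h2 := hmp.measureReal_preimage (s := {g : ℝ | √(Fintype.card ι) ≤ |g|})
        (measurableSet_le measurable_const measurable_norm).nullMeasurableSet
      rw [← h2] at h
      exact h
    refine (Finset.sum_le_sum fun x _ => this x).trans ?_
    simp
  · refine (measureReal_iUnion_fintype_le _).trans ?_
    have : ∀ x₀ : ι, P.real (⋃ j ∈ Finset.range (2 * Fintype.card ι ^ 3 + 1),
        {H | δ * √(Fintype.card ι) ≤
          ∑ x, excess ((j : ℝ) / (Fintype.card ι : ℝ) ^ 2 / a x₀ * a x) (H x)}) ≤
        (2 * Fintype.card ι ^ 3 + 1) * Real.exp (-r * (δ * √(Fintype.card ι))) := by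
      intro x₀
      refine (measureReal_biUnion_finset_le _ _).trans ?_
      refine (Finset.sum_le_sum fun j _ => measure_pi_sum_excess_le hr hr4 hmom ?_ _).trans ?_
      · intro x
        have := ha x
        have := ha x₀
        positivity
      · simp
    refine (Finset.sum_le_sum fun x _ => this x).trans ?_
    simp [mul_assoc]

end Supremum

/-! ### The central limit theorem on product spaces -/

section CentralLimit

open scoped RealInnerProductSpace

variable {Ω : Type*} [MeasurableSpace Ω] {P : Measure Ω}
  {E : Type*} [NormedAddCommGroup E] [InnerProductSpace ℝ E] [FiniteDimensional ℝ E]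
  [MeasurableSpace E] [BorelSpace E]

lemma charFun_map_smul_eq {X : Ω → E} (hX : Measurable X) (t : E) (u : ℝ) :
    charFun (P.map X) (u • t) = charFun (P.map fun ω => ⟪X ω, t⟫) u := by
  rw [charFun_apply, charFun_apply_real, integral_map hX.aemeasurable
    (by fun_prop), integral_map (by fun_prop) (by fun_prop)]
  simp_rw [real_inner_smul_right]
  push_cast
  rfl

variable [IsProbabilityMeasure P]

lemma charFun_map_inv_sqrt_smul_sum {X : Ω → E} (hX : Measurable X) (N : ℕ) (t : E) :
    charFun ((Measure.pi fun _ : Fin N => P).map fun ω => (√N)⁻¹ • ∑ i, X (ω i)) t =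
      charFun (P.map X) ((√N)⁻¹ • t) ^ N := by
  have hsum : Measurable fun ω : Fin N → Ω => ∑ i, X (ω i) :=
    Finset.measurable_sum _ fun i _ => hX.comp (measurable_pi_apply i)
  have hmp : Measurable fun (ω : Fin N → Ω) i => X (ω i) :=
    measurable_pi_lambda _ fun i => hX.comp (measurable_pi_apply i)
  rw [charFun_map_smul_comp hsum.aemeasurable]
  have := Measure.isProbabilityMeasure_map (μ := P) hX.aemeasurable
  have h := charFun_map_sum_pi_eq_prod (fun _ : Fin N => P.map X)
  rw [← Measure.pi_map_pi (fun _ => hX.aemeasurable),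
    Measure.map_map (by fun_prop) hmp] at h
  have h2 := congrFun h ((√N)⁻¹ • t)
  simp only [Finset.prod_const, Finset.card_univ, Fintype.card_fin, Pi.pow_apply] at h2
  exact h2

/-- The Cramér–Wold reduction: along the direction of t the sum is a real i.i.d. sum with mean 0 and
variance 1, and the one-dimensional limit is evaluated at ‖t‖. -/
lemma tendsto_charFun_map_inv_sqrt_smul_sum {X : Ω → E} (hX : Measurable X)
    (h0 : ∀ e : E, ‖e‖ = 1 → ∫ ω, ⟪X ω, e⟫ ∂P = 0)
    (h1 : ∀ e : E, ‖e‖ = 1 → ∫ ω, ⟪X ω, e⟫ ^ 2 ∂P = 1) (t : E) :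
    Tendsto (fun N : ℕ => charFun ((Measure.pi fun _ : Fin N => P).map
      fun ω => (√N)⁻¹ • ∑ i, X (ω i)) t) atTop (𝓝 (Complex.exp (-‖t‖ ^ 2 / 2))) := by
  simp_rw [charFun_map_inv_sqrt_smul_sum hX]
  rcases eq_or_ne t 0 with rfl | ht
  · have := Measure.isProbabilityMeasure_map (μ := P) hX.aemeasurable
    simp
  set e := (‖t‖)⁻¹ • t with he
  have hn : ‖t‖ ≠ 0 := norm_ne_zero_iff.2 ht
  have hen : ‖e‖ = 1 := by rw [he, norm_smul, norm_inv, norm_norm, inv_mul_cancel₀ hn]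
  have hte : t = ‖t‖ • e := by rw [he, smul_smul, mul_inv_cancel₀ hn, one_smul]
  have h := tendsto_charFun_inv_sqrt_mul_pow (P := P) (X := fun ω => ⟪X ω, e⟫)
    (by fun_prop) (h0 e hen) (h1 e hen) ‖t‖
  refine h.congr fun N => ?_
  rw [← charFun_map_smul_eq hX e, mul_smul, ← hte]

/-- The central limit theorem, as an upper bound for the probabilities of closed sets. -/
lemma limsup_measure_pi_closed_le {X : Ω → E} (hX : Measurable X)
    (h0 : ∀ e : E, ‖e‖ = 1 → ∫ ω, ⟪X ω, e⟫ ∂P = 0)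
    (h1 : ∀ e : E, ‖e‖ = 1 → ∫ ω, ⟪X ω, e⟫ ^ 2 ∂P = 1)
    {ν : Measure E} [IsProbabilityMeasure ν]
    (hν : ∀ t, charFun ν t = Complex.exp (-‖t‖ ^ 2 / 2)) {F : Set E} (hF : IsClosed F) :
    limsup (fun N : ℕ => (Measure.pi fun _ : Fin N => P)
      {ω | (√N)⁻¹ • ∑ i, X (ω i) ∈ F}) atTop ≤ ν F := by
  have hmeas : ∀ N : ℕ, Measurable fun ω : Fin N → Ω => (√N)⁻¹ • ∑ i, X (ω i) :=
    fun N => (Finset.measurable_sum _ fun i _ => hX.comp (measurable_pi_apply i)).const_smul _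
  let law : ℕ → ProbabilityMeasure E := fun N =>
    ⟨(Measure.pi fun _ : Fin N => P).map fun ω => (√N)⁻¹ • ∑ i, X (ω i),
      Measure.isProbabilityMeasure_map (hmeas N).aemeasurable⟩
  let limit : ProbabilityMeasure E := ⟨ν, inferInstance⟩
  have hlim : Tendsto law atTop (𝓝 limit) := by
    rw [ProbabilityMeasure.tendsto_iff_tendsto_charFun]
    intro t
    have := tendsto_charFun_map_inv_sqrt_smul_sum hX h0 h1 t
    rw [← hν t] at this
    exact this
  have h := ProbabilityMeasure.limsup_measure_closed_le_of_tendsto hlim hF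
  refine le_trans (le_of_eq ?_) h
  congr 1
  ext N
  exact (Measure.map_apply (hmeas N) hF.measurableSet).symm

end CentralLimit

/-- Transfers the limit in M, taken along `Fin M`, to an arbitrary set of profiles of cardinality M.
-/
lemma measure_pi_sum_mem_eq {Ω : Type*} [MeasurableSpace Ω] {P : Measure Ω}
    [IsProbabilityMeasure P] {ι : Type u} [Fintype ι] (f : Ω → ℝ) (S : Set ℝ) :
    (Measure.pi fun _ : ι => P) {H | ∑ x, f (H x) ∈ S} =
      (Measure.pi fun _ : Fin (Fintype.card ι) => P) {H | ∑ i, f (H i) ∈ S} := by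
  set e := Fintype.equivFin ι
  have hmp := measurePreserving_piCongrLeft (α := fun _ => Ω) (fun _ : Fin (Fintype.card ι) => P) e
  rw [← hmp.measure_preimage_equiv]
  congr 1
  ext H
  simp only [Set.mem_preimage, Set.mem_ofPred_eq]
  rw [← Equiv.sum_comp e]
  have : ∀ x, (MeasurableEquiv.piCongrLeft (fun _ => Ω) e) H (e x) = H x := fun x => by
    simp [MeasurableEquiv.coe_piCongrLeft, Equiv.piCongrLeft_apply_apply]
  simp_rw [this]

/-! ### The Gaussian quantile -/

lemma measureReal_Ioi_eq (y : ℝ) : (gaussianReal 0 1).real (Set.Ioi y) = stdTail y := by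
  rw [measureReal_def, gaussianReal_apply_eq_integral 0 one_ne_zero]
  simp_rw [← stdDensity_eq]
  exact ENNReal.toReal_ofReal (stdTail_nonneg y)

lemma measure_Ici_eq (y : ℝ) : (gaussianReal 0 1) (Set.Ici y) = ENNReal.ofReal (stdTail y) := by
  rw [gaussianReal_apply_eq_integral 0 one_ne_zero, integral_Ici_eq_integral_Ioi]
  simp_rw [← stdDensity_eq]
  rfl

lemma cdf_gaussianReal_eq (y : ℝ) : cdf (gaussianReal 0 1) y = 1 - stdTail y := by
  rw [cdf_eq_real, ← measureReal_Ioi_eq, ← Set.compl_Iic,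
    probReal_compl_eq_one_sub measurableSet_Iic]
  ring

/-- The infimum defining the quantile is attained by continuity of the tail, over a set bounded
below by 0 because the tail at 0 is 1/2. -/
lemma gaussianQuantile_spec {α : ℝ} (h0 : 0 < α) (h1 : α ≤ 1 / 2) :
    0 ≤ gaussianQuantile (1 - α) ∧ stdTail (gaussianQuantile (1 - α)) ≤ α := by
  have hset : {z : ℝ | 1 - α ≤ cdf (gaussianReal 0 1) z} = {z | stdTail z ≤ α} := by
    ext z
    simp only [Set.mem_ofPred_eq, cdf_gaussianReal_eq]
    constructor <;> intro h <;> linarith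
  have hlow : ∀ z ∈ {z | stdTail z ≤ α}, 0 ≤ z := by
    intro z hz
    rw [Set.mem_ofPred_eq] at hz
    by_contra hneg
    have := strictAnti_stdTail (not_le.1 hneg)
    rw [stdTail_zero] at this
    linarith
  have hne : {z | stdTail z ≤ α}.Nonempty := by
    obtain ⟨z, hz⟩ := (tendsto_stdTail.eventually (gt_mem_nhds h0)).exists
    exact ⟨z, hz.le⟩
  have hmem := (isClosed_le continuous_stdTail continuous_const).csInf_mem hne ⟨0, hlow⟩
  unfold gaussianQuantile
  rw [hset]
  exact ⟨hlow _ hmem, hmem⟩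

lemma callVar_pos (s : ℝ) (hs : 0 ≤ s) : 0 < callVar s := by
  refine pos_of_deriv_neg_of_tendsto (fun x _ => hasDerivAt_callVar x) (fun x hx => ?_) ?_
  · have h1 : stdTail x ≤ 1 / 2 := stdTail_zero ▸ strictAnti_stdTail.antitone (hs.trans hx)
    have h2 := stdCall_pos x
    have : 0 < 2 * stdCall x * (1 - stdTail x) := mul_pos (by linarith) (by linarith)
    linarith
  · have := tendsto_stdSqCall.sub (tendsto_stdCall.pow 2)
    norm_num at this
    exact this

/-- The standard deviation of the censored contribution at the optimal scale. -/
def optDev : ℝ := √(4 * meanArgmax ^ 2 * callVar meanArgmax)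

/-- The maximal standard deviation of a censored contribution. -/
def maxDev : ℝ := √(4 * varArgmax ^ 2 * callVar varArgmax)

lemma optDev_pos : 0 < optDev := by
  have h := meanArgmax_mem.1
  have := callVar_pos meanArgmax (by linarith)
  have : 0 < meanArgmax := by linarith
  unfold optDev; positivity

lemma optDev_lt_maxDev : optDev < maxDev := by
  have h := meanArgmax_mem.1
  have := callVar_pos meanArgmax (by linarith)
  exact Real.sqrt_lt_sqrt (by positivity) sq_mul_callVar_meanArgmax_lt

lemma maxDev_sq : maxDev ^ 2 = 4 * varArgmax ^ 2 * callVar varArgmax := by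
  have h := varArgmax_mem.1
  have := callVar_pos varArgmax (by linarith)
  exact Real.sq_sqrt (by positivity)

/-- Of the two δ, one pays for the excess over the net and the other, multiplied by √M, for the
additive constants. -/
lemma exists_slack {α ε : ℝ} (h0 : 0 < α) (hε : 0 ≤ ε) (h : α < 1 / 2 ∨ (α = 1 / 2 ∧ 0 < ε)) :
    ∃ δ τ : ℝ, 0 < δ ∧ τ + 2 * δ ≤ maxDev * gaussianQuantile (1 - α) ∧
      stdTail (τ / optDev) < α + ε := by
  have hσ := optDev_pos
  have hlt := optDev_lt_maxDev
  obtain ⟨hz0, hz⟩ := gaussianQuantile_spec h0 (h.elim le_of_lt fun h => h.1.le)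
  set z := gaussianQuantile (1 - α)
  rcases h with h | ⟨h, hε'⟩
  · have hzpos : 0 < z := by
      refine lt_of_le_of_ne hz0 fun heq => ?_
      rw [← heq, stdTail_zero] at hz
      linarith
    have hgap : optDev * z < maxDev * z := mul_lt_mul_of_pos_right hlt hzpos
    -- τ is the midpoint of `optDev * z` and `maxDev * z`, and 2δ is the other half of the gap.
    refine ⟨(maxDev * z - optDev * z) / 4, (maxDev * z + optDev * z) / 2, by linarith,
      by linarith, ?_⟩
    have : z < (maxDev * z + optDev * z) / 2 / optDev := by
      rw [lt_div_iff₀ hσ]; linarith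
    linarith [strictAnti_stdTail this]
  · have hlim : ∀ᶠ y in 𝓝 (0 : ℝ), stdTail y < α + ε :=
      continuous_stdTail.continuousAt.eventually (gt_mem_nhds (by rw [stdTail_zero]; linarith))
    obtain ⟨η, hη, hball⟩ := Metric.eventually_nhds_iff.1 hlim
    have hy : stdTail (-(η / 2)) < α + ε := hball (by simp [abs_of_pos hη]; linarith)
    -- Here z may vanish and there may be no gap; τ is lowered by a small amount, which by
    -- continuity of the tail costs less than ε.
    refine ⟨η / 2 * optDev / 2, maxDev * z - η / 2 * optDev, by positivity, by linarith, ?_⟩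
    refine lt_of_le_of_lt (strictAnti_stdTail.antitone ?_) hy
    rw [le_div_iff₀ hσ]
    nlinarith [mul_nonneg (hσ.trans hlt).le hz0]

/-! ### The uniform Gaussian bound -/

/-- At the common scale `optScale` the terms are i.i.d. with mean `maxMean` and standard deviation
`optDev`, so the ordinary central limit theorem applies as M grows. -/
lemma limsup_measure_pi_optScale_le (τ : ℝ) :
    limsup (fun M : ℕ => (Measure.pi fun _ : Fin M => gaussianReal 0 1)
      {H | maxMean * M + τ * √M ≤ ∑ i, censoredContribution optScale (H i)}) atTop ≤
      ENNReal.ofReal (stdTail (τ / optDev)) := by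
  have hσ := optDev_pos
  have ht := optScale_pos
  have hhalf : optScale / 2 = meanArgmax := by unfold optScale; ring
  set X : ℝ → ℝ := fun g => optDev⁻¹ * (censoredContribution optScale g - maxMean) with hX
  have hXc : Continuous X := continuous_const.mul
    ((continuous_censoredContribution _).sub continuous_const)
  have hmean : ∫ g, censoredContribution optScale g ∂(gaussianReal 0 1) = maxMean := by
    rw [integral_censoredContribution ht.le, hhalf]; rfl
  have hX0 : ∫ g, X g ∂(gaussianReal 0 1) = 0 := by
    rw [hX, integral_const_mul, integral_sub (integrable_censoredContribution ht.le)
      (integrable_const _), hmean]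
    simp
  have hX1 : ∫ g, X g ^ 2 ∂(gaussianReal 0 1) = 1 := by
    simp_rw [hX, mul_pow]
    rw [integral_const_mul, ← hmean,
      ← variance_eq_integral (continuous_censoredContribution _).aemeasurable]
    have := censoredVariance_eq ht
    unfold censoredVariance at this
    rw [this, hhalf]
    have h2 : optDev ^ 2 = 4 * meanArgmax ^ 2 * callVar meanArgmax :=
      Real.sq_sqrt (by have := callVar_pos meanArgmax (by linarith [meanArgmax_mem.1]); positivity)
    rw [← h2, inv_pow, inv_mul_cancel₀ (by positivity)]
  have hunit : ∀ e : ℝ, ‖e‖ = 1 → e ^ 2 = 1 := fun e he => by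
    rw [← sq_abs, ← Real.norm_eq_abs, he]; norm_num
  have h := limsup_measure_pi_closed_le (P := gaussianReal 0 1) (X := X) hXc.measurable
    (fun e _ => by
      simp only [Real.inner_apply]
      rw [integral_mul_const, hX0, zero_mul])
    (fun e he => by
      simp only [Real.inner_apply, mul_pow, hunit e he, mul_one]
      exact hX1)
    (ν := gaussianReal 0 1)
    (fun t => by
      rw [charFun_gaussianReal]
      congr 1
      rw [Real.norm_eq_abs, ← Complex.ofReal_pow |t| 2, sq_abs]
      push_cast
      ring)
    (F := Set.Ici (τ / optDev)) isClosed_Ici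
  rw [measure_Ici_eq] at h
  refine le_trans (limsup_le_limsup ?_) h
  filter_upwards [eventually_ge_atTop 1] with M hM
  refine measure_mono fun H hH => ?_
  rw [Set.mem_ofPred_eq] at hH ⊢
  have hM0 : 0 < √(M : ℝ) := Real.sqrt_pos.2 (by exact_mod_cast hM)
  rw [Set.mem_Ici, smul_eq_mul, hX, ← Finset.mul_sum, Finset.sum_sub_distrib, Finset.sum_const,
    Finset.card_univ, Fintype.card_fin, nsmul_eq_mul, div_le_iff₀ hσ]
  rw [show (√(M : ℝ))⁻¹ * (optDev⁻¹ * (∑ i, censoredContribution optScale (H i) - M * maxMean))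
    * optDev = (∑ i, censoredContribution optScale (H i) - M * maxMean) / √M by field_simp,
    le_div_iff₀ hM0]
  linarith

lemma tendsto_exceed_error {r δ : ℝ} (hr : 0 < r) (hδ : 0 < δ) :
    Tendsto (fun M : ℕ => (M : ℝ) * (expSqMoment * Real.exp (-(M / 4))) +
      M * (2 * (M : ℝ) ^ 3 + 1) * Real.exp (-r * (δ * √M))) atTop (𝓝 0) := by
  have hlin : ∀ (n : ℕ) (b : ℝ), 0 < b →
      Tendsto (fun x : ℝ => x ^ n * Real.exp (-(b * x))) atTop (𝓝 0) := by
    intro n b hb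
    have h1 : Tendsto (fun x : ℝ => b * x) atTop atTop := tendsto_id.const_mul_atTop hb
    have h := ((Real.tendsto_pow_mul_exp_neg_atTop_nhds_zero n).comp h1).const_mul ((b ^ n)⁻¹)
    rw [mul_zero] at h
    refine h.congr fun x => ?_
    simp only [Function.comp, mul_pow]
    field_simp
  have hM : Tendsto (fun M : ℕ => (M : ℝ)) atTop atTop := tendsto_natCast_atTop_atTop
  have hsM : Tendsto (fun M : ℕ => √(M : ℝ)) atTop atTop := Real.tendsto_sqrt_atTop.comp hM
  have h1 := ((hlin 1 (1 / 4) (by norm_num)).comp hM).const_mul expSqMoment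
  have h2 := ((hlin 8 (r * δ) (by positivity)).comp hsM).const_mul 2
  have h3 := (hlin 2 (r * δ) (by positivity)).comp hsM
  have h := h1.add (h2.add h3)
  simp only [mul_zero, add_zero] at h
  refine h.congr fun M => ?_
  have hsq : √(M : ℝ) ^ 2 = M := Real.sq_sqrt (Nat.cast_nonneg M)
  have hsq8 : √(M : ℝ) ^ 8 = (M : ℝ) ^ 4 := by
    rw [← hsq]; simp only [Real.sqrt_sq (Real.sqrt_nonneg _)]; ring
  simp only [Function.comp, hsq, hsq8, pow_one]
  rw [show -(1 / 4 * (M : ℝ)) = -(M / 4) by ring, show -(r * δ * √(M : ℝ)) = -r * (δ * √M) by ring]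
  ring

/-- M₀ is fixed before the index type and the scales a, which gives the uniformity over all test
laws claimed in the theorem. -/
lemma exists_uniform_gaussian_bound {α ε : ℝ} (h0 : 0 < α) (hε : 0 ≤ ε)
    (h : α < 1 / 2 ∨ (α = 1 / 2 ∧ 0 < ε)) :
    ∃ δ τ : ℝ, 0 < δ ∧ ∃ M₀ : ℕ, ∀ (ι : Type u) [Fintype ι], M₀ ≤ Fintype.card ι →
      1 ≤ Fintype.card ι ∧
      maxMean * Fintype.card ι + (τ + δ) * √(Fintype.card ι) + 4 ≤
        threshold maxMean maxDev (Fintype.card ι) α ∧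
      ∀ a : ι → ℝ, (∀ x, 0 < a x) →
        (Measure.pi fun _ : ι => gaussianReal 0 1) (exceedSet a δ τ) ≤ ENNReal.ofReal (α + ε) := by
  obtain ⟨δ, τ, hδ, hslack, htail⟩ := exists_slack h0 hε h
  obtain ⟨r, hr, hr4, hmom⟩ := exists_integral_exp_mul_excess_le_one
  obtain ⟨c, hc1, hc2⟩ := exists_between htail
  have hc0 : 0 < c := (stdTail_pos _).trans hc1
  have hE1 := tendsto_exceed_error hr hδ
  have hE2 := limsup_measure_pi_optScale_le τ
  have hev1 := hE1.eventually (gt_mem_nhds (sub_pos.2 hc2))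
  have hev2 := eventually_lt_of_limsup_lt
    (hE2.trans_lt ((ENNReal.ofReal_lt_ofReal_iff hc0).2 hc1))
  have hev3 := (Real.tendsto_sqrt_atTop.comp
    (tendsto_natCast_atTop_atTop (R := ℝ))).eventually (eventually_ge_atTop (4 / δ))
  obtain ⟨M₀, hM₀⟩ := eventually_atTop.1
    (hev1.and (hev2.and (hev3.and (eventually_ge_atTop 1))))
  refine ⟨δ, τ, hδ, M₀, fun ι _ hι => ?_⟩
  obtain ⟨h1, h2, h3, h4⟩ := hM₀ _ hι
  refine ⟨h4, ?_, fun a ha => ?_⟩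
  -- Since √M ≥ 4/δ, the second δ√M of `exists_slack` covers the constant 4.
  · simp only [Function.comp] at h3
    rw [div_le_iff₀ hδ] at h3
    unfold threshold
    nlinarith [Real.sqrt_nonneg (Fintype.card ι : ℝ)]
  · have hb := measure_pi_exceedSet_le hr hr4 hmom ha δ τ
    have h5 : (Measure.pi fun _ : ι => gaussianReal 0 1).real
        {H | maxMean * Fintype.card ι + τ * √(Fintype.card ι) ≤
          ∑ x, censoredContribution optScale (H x)} ≤ c := by
      have h6 := measure_pi_sum_mem_eq (P := gaussianReal 0 1) (ι := ι)
        (censoredContribution optScale)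
        (Set.Ici (maxMean * Fintype.card ι + τ * √(Fintype.card ι)))
      simp only [Set.mem_Ici] at h6
      rw [measureReal_def, h6]
      exact ENNReal.toReal_le_of_le_ofReal hc0.le h2.le
    rw [← ofReal_measureReal]
    exact ENNReal.ofReal_le_ofReal (by linarith)

/-! ### Deterministic bounds for the log-likelihood ratio -/

/-- Equivalent to the Padé bound (2 - u)exp(u) ≤ 2 + u. The lower bound has the exact order u²/2 at
0 and still grows linearly at infinity, so it serves every q in (0, 1]. -/
lemma sq_div_two_add_le {u : ℝ} (hu : 0 ≤ u) : u ^ 2 / (2 + u) ≤ u - 1 + Real.exp (-u) := by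
  have hd : ∀ x, HasDerivAt (fun u : ℝ => (2 + u) - (2 - u) * Real.exp u)
      (1 - (1 - x) * Real.exp x) x := fun x =>
    (((hasDerivAt_id x).const_add 2).sub (((hasDerivAt_id x).const_sub 2).mul
      (Real.hasDerivAt_exp x))).congr_deriv (by simp; ring)
  have hmono : MonotoneOn (fun u : ℝ => (2 + u) - (2 - u) * Real.exp u) (Set.Ici 0) := by
    refine monotoneOn_of_hasDerivWithinAt_nonneg (convex_Ici 0)
      (fun x _ => (hd x).continuousAt.continuousWithinAt)
      (fun x _ => (hd x).hasDerivWithinAt) fun x _ => ?_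
    have h1 := Real.add_one_le_exp (-x)
    have h2 : Real.exp x * Real.exp (-x) = 1 := by rw [← Real.exp_add]; simp
    nlinarith [Real.exp_pos x]
  have h := hmono (Set.mem_Ici.2 le_rfl) (Set.mem_Ici.2 hu) hu
  simp only [Real.exp_zero] at h
  have h2 : Real.exp u * Real.exp (-u) = 1 := by rw [← Real.exp_add]; simp
  have h3 : 2 - u ≤ (2 + u) * Real.exp (-u) := by
    nlinarith [Real.exp_pos (-u)]
  rw [div_le_iff₀ (by linarith)]
  nlinarith

/-- The function F, the difference of the two sides, vanishes at q = 1 and decreases on (0, 1]. -/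
lemma neg_log_le_of_mem {p q : ℝ} (hp : p ∈ Set.Icc (0 : ℝ) 1) (hq : q ∈ Set.Ioc (0 : ℝ) 1) :
    -Real.log (1 - p + q * p) ≤ -(p * Real.log q) - p * (1 - p) * (-Real.log q - 1 + q) := by
  set F : ℝ → ℝ := fun q => Real.log (1 - p + q * p) - p ^ 2 * Real.log q + p * (1 - p) * (1 - q)
  have hpos : ∀ x : ℝ, 0 < x → x ≤ 1 → 0 < 1 - p + x * p := by
    intro x hx hx1
    rcases hp.1.eq_or_lt with h | h
    · rw [← h]; norm_num
    · have := mul_pos hx h; linarith [hp.2]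
  have hd : ∀ x : ℝ, 0 < x → x ≤ 1 →
      HasDerivAt F (p / (1 - p + x * p) - p ^ 2 / x - p * (1 - p)) x := by
    intro x hx hx1
    have h1 : HasDerivAt (fun q : ℝ => 1 - p + q * p) p x :=
      (((hasDerivAt_id x).mul_const p).const_add (1 - p)).congr_deriv (by simp)
    exact (((h1.log (hpos x hx hx1).ne').sub ((Real.hasDerivAt_log hx.ne').const_mul (p ^ 2))).add
      (((hasDerivAt_id x).const_sub 1).const_mul (p * (1 - p)))).congr_deriv (by simp; ring)
  have hanti : AntitoneOn F (Set.Icc q 1) := by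
    refine antitoneOn_of_hasDerivWithinAt_nonpos (convex_Icc _ _)
      (fun x hx => (hd x (hq.1.trans_le hx.1) hx.2).continuousAt.continuousWithinAt)
      (fun x hx => (hd x (hq.1.trans_le (interior_subset hx).1)
        (interior_subset hx).2).hasDerivWithinAt) fun x hx => ?_
    have hx := interior_subset hx
    have hx0 : 0 < x := hq.1.trans_le hx.1
    have hden := hpos x hx0 hx.2
    -- Jensen's inequality for the convex function 1/x at the points x and 1 with weights p and 1 -
    -- p.
    have key : 1 / (1 - p + x * p) ≤ p / x + (1 - p) := by
      rw [div_le_iff₀ hden, div_add' _ _ _ hx0.ne', div_mul_eq_mul_div, le_div_iff₀ hx0]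
      nlinarith [mul_nonneg hp.1 (sub_nonneg.2 hp.2), sq_nonneg (1 - x),
        mul_nonneg (mul_nonneg hp.1 (sub_nonneg.2 hp.2)) (sq_nonneg (1 - x))]
    have h2 := mul_le_mul_of_nonneg_left key hp.1
    have h3 : p * (1 / (1 - p + x * p)) = p / (1 - p + x * p) := by ring
    have h4 : p * (p / x + (1 - p)) = p ^ 2 / x + p * (1 - p) := by ring
    linarith
  have h := hanti ⟨le_rfl, hq.2⟩ ⟨hq.2, le_rfl⟩ hq.2
  simp only [F, one_mul, sub_add_cancel, Real.log_one, mul_zero, sub_self] at h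
  nlinarith

/-- The contribution of a single record to the log-likelihood ratio at `q = exp (-u)`. -/
lemma record_le {p q : ℝ} (hp : p ∈ Set.Icc (0 : ℝ) 1) (hq : q ∈ Set.Ioc (0 : ℝ) 1) (y : ℝ) :
    y * Real.log q - Real.log (1 - p + q * p) ≤
      (p - y) * -Real.log q - p * (1 - p) * ((-Real.log q) ^ 2 / (2 + -Real.log q)) := by
  have hu : 0 ≤ -Real.log q := neg_nonneg.2 (Real.log_nonpos hq.1.le hq.2)
  have h1 := sq_div_two_add_le hu
  rw [neg_neg, Real.exp_log hq.1] at h1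
  have h2 := neg_log_le_of_mem hp hq
  have h3 := mul_le_mul_of_nonneg_left h1 (mul_nonneg hp.1 (sub_nonneg.2 hp.2))
  linarith

/-- The argument of the logarithm at p' stays above (1 - p)/2 for all q, so the logarithm is
Lipschitz there uniformly in q; this survives the supremum over q. -/
lemma neg_log_le_neg_log_add {p p' q c : ℝ} (hp1 : p < 1) (hc : 0 < c)
    (hc2 : 1 ≤ c) (h : |p' - p| < (1 - p) / (2 * c)) (hq : q ∈ Set.Ioo (0 : ℝ) 1) (hp0 : 0 ≤ p) :
    -Real.log (1 - p' + q * p') ≤ -Real.log (1 - p + q * p) + 1 / c := by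
  obtain ⟨hl, hr⟩ := abs_lt.1 h
  have h1p : 0 < 1 - p := by linarith
  have hhalf : (1 - p) / (2 * c) ≤ (1 - p) / 2 :=
    div_le_div_of_nonneg_left h1p.le two_pos (by linarith)
  have hA : 0 < 1 - p + q * p := by have := mul_nonneg hq.1.le hp0; linarith
  have hA' : (1 - p) / 2 ≤ 1 - p' + q * p' := by
    rcases le_total 0 p' with h0 | h0
    · have := mul_nonneg hq.1.le h0; linarith
    · nlinarith [hq.1, hq.2]
  have hA'0 : 0 < 1 - p' + q * p' := by linarith
  have h2 := Real.log_le_sub_one_of_pos (div_pos hA hA'0)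
  rw [Real.log_div hA.ne' hA'0.ne'] at h2
  have h3 : (1 - p + q * p) / (1 - p' + q * p') - 1 ≤ 1 / c := by
    rw [div_sub_one hA'0.ne', div_le_div_iff₀ hA'0 hc]
    have h4 : (1 - p + q * p) - (1 - p' + q * p') = (p' - p) * (1 - q) := by ring
    have h5 : (p' - p) * (1 - q) ≤ (1 - p) / (2 * c) := by
      nlinarith [hq.1, hq.2, abs_nonneg (p' - p)]
    rw [h4]
    calc (p' - p) * (1 - q) * c ≤ (1 - p) / (2 * c) * c := by gcongr
      _ = (1 - p) / 2 := by field_simp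
      _ ≤ 1 * (1 - p' + q * p') := by linarith
  linarith

/-- The quadratic upper bound for the contribution of one profile, in terms of the censored
contribution with a common scale. -/
lemma profile_le {a h u s ρ η k v : ℝ} (ha : 0 < a) (hs : 0 ≤ s) (hu : 0 ≤ u) (hρ : 0 < ρ)
    (hη : 0 < η) (hk : ρ * s ^ 2 * a ^ 2 ≤ k * v) (hh : h ≤ ρ / (1 + η) * η * a * s) :
    s * a * h * u - k * v * (u ^ 2 / (2 + u)) ≤
      (ρ / (1 + η))⁻¹ * censoredContribution (ρ / (1 + η) * (s * min u (2 * η)) * a) h := by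
  set r := ρ / (1 + η) with hr
  have hr0 : 0 < r := by positivity
  have hρr : ρ = r * (1 + η) := by rw [hr]; field_simp
  have hd : 0 < 2 + u := by linarith
  have h1 : ρ * s ^ 2 * a ^ 2 * (u ^ 2 / (2 + u)) ≤ k * v * (u ^ 2 / (2 + u)) :=
    mul_le_mul_of_nonneg_right hk (by positivity)
  rcases le_or_gt u (2 * η) with hle | hgt
  · rw [min_eq_left hle]
    -- Small u: the penalty is quadratic up to the factor 1 + η. Rescaling by r = ρ/(1 + η)
    -- completes it to an exact tH - t²/2.
    have h2 : u ^ 2 / (2 * (1 + η)) ≤ u ^ 2 / (2 + u) :=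
      div_le_div_of_nonneg_left (sq_nonneg u) hd (by linarith)
    have h3 : ρ * s ^ 2 * a ^ 2 * (u ^ 2 / (2 * (1 + η))) ≤
        ρ * s ^ 2 * a ^ 2 * (u ^ 2 / (2 + u)) := mul_le_mul_of_nonneg_left h2 (by positivity)
    have h4 : ρ * s ^ 2 * a ^ 2 * (u ^ 2 / (2 * (1 + η))) = r * s ^ 2 * a ^ 2 * u ^ 2 / 2 := by
      rw [hρr]; field_simp
    have h5 : r * (s * u) * a * h - (r * (s * u) * a) ^ 2 / 2 ≤
        censoredContribution (r * (s * u) * a) h := le_max_left _ _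
    have h6 := mul_le_mul_of_nonneg_left h5 (inv_nonneg.2 hr0.le)
    have h7 : r⁻¹ * (r * (s * u) * a * h - (r * (s * u) * a) ^ 2 / 2) =
        s * a * h * u - r * s ^ 2 * a ^ 2 * u ^ 2 / 2 := by field_simp
    linarith
  · have h8 : 0 ≤ r⁻¹ * censoredContribution (r * (s * min u (2 * η)) * a) h :=
      mul_nonneg (inv_nonneg.2 hr0.le) (censoredContribution_nonneg _ _)
    -- Large u: the penalty is at least linear in u and dominates the linear term by `hh`, so the
    -- left side is nonpositive. This is why u may be capped at 2η in the common scale.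
    have h9 : η / (1 + η) ≤ u / (2 + u) := by
      rw [div_le_div_iff₀ (by linarith) hd]; nlinarith
    have h10 : ρ * s ^ 2 * a ^ 2 * u * (η / (1 + η)) ≤ ρ * s ^ 2 * a ^ 2 * u * (u / (2 + u)) :=
      mul_le_mul_of_nonneg_left h9 (by positivity)
    have h11 : ρ * s ^ 2 * a ^ 2 * u * (u / (2 + u)) = ρ * s ^ 2 * a ^ 2 * (u ^ 2 / (2 + u)) := by
      ring
    have h12 : ρ * s ^ 2 * a ^ 2 * u * (η / (1 + η)) = r * η * a * s * (s * a * u) := by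
      rw [hr]; ring
    have h13 : h * (s * a * u) ≤ r * η * a * s * (s * a * u) :=
      mul_le_mul_of_nonneg_right hh (by positivity)
    nlinarith

lemma sum_filter_eq_sum_profiles {V : Type u} {A : Set V} [Fintype A] {N : ℕ}
    {D : Fin N → V × Bool} (hD : ∀ i, (D i).1 ∈ A) (S : Set V) (g : V × Bool → ℝ) :
    open Classical in
    ∑ i with (D i).1 ∈ S, g (D i) =
      ∑ x : A, if (x : V) ∈ S then ∑ i, (if (D i).1 = x then g (D i) else 0) else 0 := by
  classical
  have : ∀ x : A, (if (x : V) ∈ S then ∑ i, (if (D i).1 = x then g (D i) else 0) else 0) =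
      ∑ i, (if (x : V) ∈ S then (if (D i).1 = x then g (D i) else 0) else 0) := by
    intro x; split_ifs <;> simp
  simp_rw [this]
  rw [Finset.sum_comm, Finset.sum_filter]
  refine Finset.sum_congr rfl fun i _ => ?_
  rw [Finset.sum_eq_single (⟨(D i).1, hD i⟩ : A)]
  · simp
  · intro x _ hx
    have : (D i).1 ≠ x := fun h => hx (Subtype.ext h.symm)
    simp [this]
  · simp

/-! ### Laws with finitely many profiles -/

section FiniteSupport

variable {V : Type u}

lemma covariateLaw_apply (f : PMF (V × Bool)) (x : V) :
    covariateLaw f x = f (x, true) + f (x, false) := by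
  classical
  unfold covariateLaw
  rw [PMF.map_apply]
  refine (ENNReal.tsum_prod (f := fun v y => if x = v then f (v, y) else 0)).trans ?_
  rw [tsum_eq_single x]
  · rw [tsum_bool]; simp [add_comm]
  · intro y hy
    simp [hy.symm]

lemma toReal_covariateLaw (f : PMF (V × Bool)) (x : V) :
    (covariateLaw f x).toReal = (f (x, true)).toReal + (f (x, false)).toReal := by
  rw [covariateLaw_apply, ENNReal.toReal_add (f.apply_ne_top _) (f.apply_ne_top _)]

lemma toReal_covariateLaw_pos {f : PMF (V × Bool)} {x : V} (hx : x ∈ (covariateLaw f).support) :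
    0 < (covariateLaw f x).toReal :=
  ENNReal.toReal_pos ((PMF.mem_support_iff _ _).1 hx) ((covariateLaw f).apply_ne_top _)

lemma toReal_apply_true {f : PMF (V × Bool)} {x : V} (hx : x ∈ (covariateLaw f).support) :
    (f (x, true)).toReal = (covariateLaw f x).toReal * condProb f x := by
  have := (toReal_covariateLaw_pos hx).ne'
  unfold condProb; field_simp

lemma toReal_apply_false {f : PMF (V × Bool)} {x : V} (hx : x ∈ (covariateLaw f).support) :
    (f (x, false)).toReal = (covariateLaw f x).toReal * (1 - condProb f x) := by
  have h := toReal_covariateLaw f x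
  rw [toReal_apply_true hx] at h
  linarith

lemma fst_mem_support {f : PMF (V × Bool)} {z : V × Bool} (hz : z ∈ f.support) :
    z.1 ∈ (covariateLaw f).support := by
  unfold covariateLaw
  rw [PMF.support_map]
  exact Set.mem_image_of_mem _ hz

variable [MeasurableSpace V] [MeasurableSingletonClass V]

lemma integral_toMeasure_of_support_subset {β : Type u} [MeasurableSpace β]
    [MeasurableSingletonClass β] (f : PMF β) (s : Finset β) (hs : f.support ⊆ s) (φ : β → ℝ) :
    ∫ z, φ z ∂f.toMeasure = ∑ z ∈ s, (f z).toReal * φ z := by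
  have hf : f.toMeasure = ∑ z ∈ s, f z • Measure.dirac z := by
    ext t ht
    rw [PMF.toMeasure_apply _ ht, Measure.finsetSum_apply, tsum_eq_sum (s := s)]
    · refine Finset.sum_congr rfl fun z _ => ?_
      rw [Measure.smul_apply, Measure.dirac_apply' _ ht, smul_eq_mul]
      by_cases hz : z ∈ t <;> simp [hz]
    · intro z hz
      have : f z = 0 := by
        by_contra h
        exact hz (hs ((PMF.mem_support_iff _ _).2 h))
      simp [Set.indicator, this]
  rw [hf, integral_finsetSum_measure]
  · refine Finset.sum_congr rfl fun z _ => ?_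
    rw [integral_smul_measure, integral_dirac, smul_eq_mul]
  · intro z _
    exact (integrable_dirac (by simp)).smul_measure (f.apply_ne_top z)

lemma integral_toMeasure_eq_sum_profiles (f : PMF (V × Bool)) [Fintype (covariateLaw f).support]
    (φ : V × Bool → ℝ) :
    ∫ z, φ z ∂f.toMeasure = ∑ x : (covariateLaw f).support, (covariateLaw f x).toReal *
      (condProb f x * φ (x, true) + (1 - condProb f x) * φ (x, false)) := by
  classical
  rw [integral_toMeasure_of_support_subset f ((covariateLaw f).support.toFinset ×ˢ Finset.univ),
    Finset.sum_product]
  · rw [Finset.sum_subtype (p := fun x => x ∈ (covariateLaw f).support) _ (by simp)]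
    refine Finset.sum_congr rfl fun x _ => ?_
    rw [Fintype.sum_bool, toReal_apply_true x.2, toReal_apply_false x.2]
    ring
  · intro z hz
    simpa using fst_mem_support hz

end FiniteSupport

/-! ### The normalized counts -/

section NormalizedCounts

variable {V : Type u}

/-- The indicator of the outcome `Y = 1`, as a real number. -/
def outcome (y : Bool) : ℝ := if y then 1 else 0

/-- The standard deviation of `1{X = x} (Y - p(x))`. -/
def profileScale (f : PMF (V × Bool)) (x : V) : ℝ :=
  √((covariateLaw f x).toReal * (condProb f x * (1 - condProb f x)))

/-- Every profile in the support has a nondegenerate outcome. -/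
def Nondegenerate (f : PMF (V × Bool)) : Prop :=
  ∀ x ∈ (covariateLaw f).support, 0 < condProb f x ∧ condProb f x < 1

lemma Nondegenerate.profileScale_pos {f : PMF (V × Bool)} (hf : Nondegenerate f) {x : V}
    (hx : x ∈ (covariateLaw f).support) : 0 < profileScale f x :=
  Real.sqrt_pos.2 (mul_pos (toReal_covariateLaw_pos hx)
    (mul_pos (hf x hx).1 (sub_pos.2 (hf x hx).2)))

lemma Nondegenerate.profileScale_sq {f : PMF (V × Bool)} (hf : Nondegenerate f) {x : V}
    (hx : x ∈ (covariateLaw f).support) : profileScale f x ^ 2 =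
      (covariateLaw f x).toReal * (condProb f x * (1 - condProb f x)) :=
  Real.sq_sqrt (mul_pos (toReal_covariateLaw_pos hx)
    (mul_pos (hf x hx).1 (sub_pos.2 (hf x hx).2))).le

open Classical in
/-- The standardized residual of a record, attributed to its profile. -/
def residual (f : PMF (V × Bool)) (x : V) (z : V × Bool) : ℝ :=
  if z.1 = x then (condProb f x - outcome z.2) / profileScale f x else 0

open Classical in
/-- The number of records with profile `x`. -/
def profileCount {N : ℕ} (D : Fin N → V × Bool) (x : V) : ℝ :=
  ∑ i, if (D i).1 = x then 1 else 0

/-- The normalized sums of the residuals of a data set. -/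
def residualSum (f : PMF (V × Bool)) {N : ℕ} (D : Fin N → V × Bool) (x : V) : ℝ :=
  (√N)⁻¹ * ∑ i, residual f x (D i)

/-- Z depends on q but not on the profile, which is what reduces the problem to a one-parameter
supremum. The hypothesis `hres` excludes residuals of order √N, so that values of q far from 1 do
not help. -/
lemma logLikelihoodRatio_le {f : PMF (V × Bool)} (hf : Nondegenerate f)
    [Fintype (covariateLaw f).support] {N : ℕ} (hN : 0 < N) {D : Fin N → V × Bool}
    (hD : ∀ i, (D i).1 ∈ (covariateLaw f).support) {ρ η : ℝ} (hρ : 0 < ρ) (hη : 0 < η)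
    (hcount : ∀ x ∈ (covariateLaw f).support,
      ρ * N * (covariateLaw f x).toReal ≤ profileCount D x)
    (hres : ∀ x ∈ (covariateLaw f).support,
      residualSum f D x ≤ ρ / (1 + η) * η * profileScale f x * √N)
    (S : Set V) {q : ℝ} (hq : q ∈ Set.Ioo (0 : ℝ) 1) :
    ∃ Z, 0 ≤ Z ∧ logLikelihoodRatio (condProb f) D S q ≤ (ρ / (1 + η))⁻¹ *
      ∑ x : (covariateLaw f).support,
        censoredContribution (Z * profileScale f x) (residualSum f D x) := by
  classical
  set u := -Real.log q with hu
  have hu0 : 0 ≤ u := neg_nonneg.2 (Real.log_nonpos hq.1.le hq.2.le)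
  have hs0 : 0 < √(N : ℝ) := Real.sqrt_pos.2 (by exact_mod_cast hN)
  set g : V × Bool → ℝ := fun z => (condProb f z.1 - outcome z.2) * u -
    condProb f z.1 * (1 - condProb f z.1) * (u ^ 2 / (2 + u)) with hg
  refine ⟨ρ / (1 + η) * (√N * min u (2 * η)), by positivity, ?_⟩
  have h1 : logLikelihoodRatio (condProb f) D S q ≤ ∑ i with (D i).1 ∈ S, g (D i) := by
    unfold logLikelihoodRatio
    rw [← Finset.sum_sub_distrib]
    refine Finset.sum_le_sum fun i _ => ?_
    have hp := hf _ (hD i)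
    exact record_le ⟨hp.1.le, hp.2.le⟩ ⟨hq.1, hq.2.le⟩ _
  refine h1.trans ?_
  rw [sum_filter_eq_sum_profiles hD, Finset.mul_sum]
  refine Finset.sum_le_sum fun x _ => ?_
  have ha := hf.profileScale_pos x.2
  have h2 : ∑ i, (if (D i).1 = x then g (D i) else 0) =
      √N * profileScale f x * residualSum f D x * u -
        profileCount D x * (condProb f x * (1 - condProb f x)) * (u ^ 2 / (2 + u)) := by
    have h3 : √N * profileScale f x * residualSum f D x =
        ∑ i, profileScale f x * residual f x (D i) := by
      unfold residualSum
      rw [← Finset.mul_sum]; field_simp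
    rw [h3, Finset.sum_mul]
    unfold profileCount
    rw [Finset.sum_mul, Finset.sum_mul, ← Finset.sum_sub_distrib]
    refine Finset.sum_congr rfl fun i _ => ?_
    unfold residual
    split_ifs with h
    · simp only [hg, h]; field_simp
    · ring
  have h4 := profile_le (k := profileCount D x) (v := condProb f x * (1 - condProb f x))
    ha hs0.le hu0 hρ hη (by
      have hv := mul_pos (hf x x.2).1 (sub_pos.2 (hf x x.2).2)
      rw [Real.sq_sqrt (Nat.cast_nonneg N), hf.profileScale_sq x.2, ← mul_assoc]
      exact mul_le_mul_of_nonneg_right (hcount x x.2) hv.le) (hres x x.2)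
  -- A profile outside S contributes 0, and its bound is a positive part.
  split_ifs with hxS
  · rw [h2]; exact h4
  · exact mul_nonneg (by positivity) (censoredContribution_nonneg _ _)

/-- Each record loses at most 1/(N + 1), and there are at most N of them in S. The required accuracy
depends on N, which is harmless because n tends to infinity first. -/
lemma logLikelihoodRatio_le_add_one {p p' : V → ℝ} {N : ℕ} {D : Fin N → V × Bool}
    (hp : ∀ i, 0 < p (D i).1 ∧ p (D i).1 < 1)
    (hp' : ∀ i, |p' (D i).1 - p (D i).1| < (1 - p (D i).1) / (2 * (N + 1)))
    (S : Set V) {q : ℝ} (hq : q ∈ Set.Ioo (0 : ℝ) 1) :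
    logLikelihoodRatio p' D S q ≤ logLikelihoodRatio p D S q + 1 := by
  classical
  unfold logLikelihoodRatio
  have hN : (0 : ℝ) < N + 1 := by positivity
  have h : ∑ i with (D i).1 ∈ S, -Real.log (1 - p' (D i).1 + q * p' (D i).1) ≤
      ∑ i with (D i).1 ∈ S, (-Real.log (1 - p (D i).1 + q * p (D i).1) + 1 / ((N : ℝ) + 1)) :=
    Finset.sum_le_sum fun i _ =>
      neg_log_le_neg_log_add (hp i).2 hN (by linarith [Nat.cast_nonneg (α := ℝ) N]) (hp' i) hq
        (hp i).1.le
  rw [Finset.sum_add_distrib, Finset.sum_neg_distrib, Finset.sum_neg_distrib, Finset.sum_const,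
    nsmul_eq_mul] at h
  have hcard : (((Finset.univ.filter fun i => (D i).1 ∈ S).card : ℕ) : ℝ) * (1 / ((N : ℝ) + 1))
      ≤ 1 := by
    have h2 : (((Finset.univ.filter fun i => (D i).1 ∈ S).card : ℕ) : ℝ) ≤ N := by
      exact_mod_cast (Finset.card_filter_le _ _).trans_eq (by simp)
    rw [mul_one_div, div_le_one hN]
    linarith
  linarith

/-- Unless the normalized sums fall into the exceedance set, every log-likelihood ratio is small. -/
lemma logLikelihoodRatio_le_of_notMem_exceedSet {f : PMF (V × Bool)} (hf : Nondegenerate f)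
    [Fintype (covariateLaw f).support] [Nonempty (covariateLaw f).support]
    {N : ℕ} (hN : 0 < N) {D : Fin N → V × Bool}
    (hD : ∀ i, (D i).1 ∈ (covariateLaw f).support) {ρ η δ τ B : ℝ} (hδ : 0 ≤ δ) (hρ : 0 < ρ)
    (hη : 0 < η)
    (hB : maxMean * Fintype.card (covariateLaw f).support +
      (τ + δ) * √(Fintype.card (covariateLaw f).support) + 1 ≤ B)
    (hρη : (|B| + 1) / (|B| + 2) ≤ ρ / (1 + η))
    (hcount : ∀ x ∈ (covariateLaw f).support,
      ρ * N * (covariateLaw f x).toReal ≤ profileCount D x)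
    (hres : ∀ x ∈ (covariateLaw f).support,
      residualSum f D x ≤ ρ / (1 + η) * η * profileScale f x * √N)
    (hex : (fun x : (covariateLaw f).support => residualSum f D x) ∉
      exceedSet (fun x : (covariateLaw f).support => profileScale f x) δ τ)
    (S : Set V) {q : ℝ} (hq : q ∈ Set.Ioo (0 : ℝ) 1) :
    logLikelihoodRatio (condProb f) D S q ≤ B + 1 := by
  obtain ⟨Z, hZ, h⟩ := logLikelihoodRatio_le hf hN hD hρ hη hcount hres S hq
  have h1 := sum_censoredContribution_le_of_notMem_exceedSet
    (a := fun x : (covariateLaw f).support => profileScale f x)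
    (fun x => hf.profileScale_pos x.2) hδ hex hZ
  have h0 : 0 ≤ ∑ x : (covariateLaw f).support,
        censoredContribution (Z * profileScale f x) (residualSum f D x) :=
    Finset.sum_nonneg fun x _ => censoredContribution_nonneg _ _
  have hB0 : 0 ≤ B := h0.trans (h1.trans hB)
  rw [abs_of_nonneg hB0] at hρη
  have hr : 0 < ρ / (1 + η) := by positivity
  refine h.trans ?_
  rw [inv_mul_le_iff₀ hr]
  -- The ratio (B + 1)/(B + 2) is chosen so that dividing B by it adds at most 1, as B(B + 2) ≤ (B +
  -- 1)².
  refine (h1.trans hB).trans (le_trans ?_ (mul_le_mul_of_nonneg_right hρη (by linarith)))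
  rw [div_mul_eq_mul_div, le_div_iff₀ (by linarith)]
  nlinarith

end NormalizedCounts

/-! ### Limit theorems for the counts and residuals of an i.i.d. sample -/

/-- The weak law of large numbers on product spaces. -/
lemma tendsto_measure_pi_abs_sum_sub {Ω : Type*} [MeasurableSpace Ω] {P : Measure Ω}
    [IsProbabilityMeasure P] {φ : Ω → ℝ} (hφ : MemLp φ 2 P) {c : ℝ} (hc : 0 < c) :
    Tendsto (fun N : ℕ => (Measure.pi fun _ : Fin N => P)
      {ω | c * N ≤ |∑ i, φ (ω i) - N * ∫ z, φ z ∂P|}) atTop (𝓝 0) := by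
  have hmem : ∀ (N : ℕ) (i : Fin N),
      MemLp (fun ω : Fin N → Ω => φ (ω i)) 2 (Measure.pi fun _ : Fin N => P) := fun N i =>
    hφ.comp_measurePreserving (measurePreserving_eval (fun _ : Fin N => P) i)
  have hbound : ∀ N : ℕ, 1 ≤ N → (Measure.pi fun _ : Fin N => P)
      {ω | c * N ≤ |∑ i, φ (ω i) - N * ∫ z, φ z ∂P|} ≤
      ENNReal.ofReal (Var[φ; P] / c ^ 2 / N) := by
    intro N hN
    have hN' : (0 : ℝ) < N := by exact_mod_cast hN
    have hint : ∫ ω, ∑ i, φ (ω i) ∂(Measure.pi fun _ : Fin N => P) = N * ∫ z, φ z ∂P := by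
      rw [integral_finsetSum _ fun i _ => (hmem N i).integrable (by norm_num)]
      have : ∀ i : Fin N, ∫ ω : Fin N → Ω, φ (ω i) ∂(Measure.pi fun _ : Fin N => P) =
          ∫ z, φ z ∂P := fun i => by
        have hmp := measurePreserving_eval (fun _ : Fin N => P) i
        have h := integral_map (μ := Measure.pi fun _ : Fin N => P) (φ := Function.eval i) (f := φ)
          hmp.measurable.aemeasurable (by rw [hmp.map_eq]; exact hφ.1)
        rw [hmp.map_eq] at h
        exact h.symm
      simp [this]
    have hvar : Var[fun ω : Fin N → Ω => ∑ i, φ (ω i); Measure.pi fun _ : Fin N => P] =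
        N * Var[φ; P] := by
      have h := variance_sum_pi (μ := fun _ : Fin N => P) (X := fun _ => φ) fun _ => hφ
      have heq : (∑ i, fun ω : Fin N → Ω => φ (ω i)) = fun ω => ∑ i, φ (ω i) := by
        ext ω; simp
      rw [heq] at h
      rw [h]; simp
    have hm : MemLp (fun ω : Fin N → Ω => ∑ i, φ (ω i)) 2 (Measure.pi fun _ : Fin N => P) :=
      memLp_finsetSum _ fun i _ => hmem N i
    have h := meas_ge_le_variance_div_sq hm (mul_pos hc hN')
    rw [hint, hvar] at h
    refine h.trans (le_of_eq ?_)
    congr 1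
    field_simp
  have hlim : Tendsto (fun N : ℕ => ENNReal.ofReal (Var[φ; P] / c ^ 2 / N)) atTop (𝓝 0) := by
    rw [← ENNReal.ofReal_zero]
    exact ENNReal.tendsto_ofReal (tendsto_const_div_atTop_nhds_zero_nat _)
  refine tendsto_of_tendsto_of_tendsto_of_le_of_le' tendsto_const_nhds hlim
    (Eventually.of_forall fun _ => zero_le) ?_
  filter_upwards [eventually_ge_atTop 1] with N hN using hbound N hN

section Data

variable {V : Type u} {f : PMF (V × Bool)}

lemma abs_residual_le (hf : Nondegenerate f) {x : V} (hx : x ∈ (covariateLaw f).support)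
    (z : V × Bool) : |residual f x z| ≤ 1 / profileScale f x := by
  have ha := hf.profileScale_pos hx
  unfold residual outcome
  split_ifs
  · rw [abs_div, abs_of_pos ha]
    have := hf x hx
    gcongr
    rw [abs_le]; constructor <;> linarith
  · rw [abs_div, abs_of_pos ha]
    have := hf x hx
    gcongr
    rw [abs_le]; constructor <;> linarith
  · simp only [abs_zero]; positivity

/-- The vector of the standardized residuals of a record. -/
def residualVec (f : PMF (V × Bool)) (z : V × Bool) :
    EuclideanSpace ℝ (covariateLaw f).support :=
  WithLp.toLp 2 fun x => residual f x z

open scoped RealInnerProductSpace in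
lemma inner_residualVec [Fintype (covariateLaw f).support]
    (e : EuclideanSpace ℝ (covariateLaw f).support) (x : (covariateLaw f).support) (b : Bool) :
    ⟪residualVec f ((x : V), b), e⟫ = (condProb f x - outcome b) / profileScale f x * e x := by
  rw [PiLp.inner_apply, Finset.sum_eq_single x]
  · simp [residualVec, residual, mul_comm]
  · intro y _ hy
    have : (x : V) ≠ y := fun h => hy (Subtype.ext h.symm)
    simp [residualVec, residual, this]
  · simp

variable [MeasurableSpace V] [MeasurableSingletonClass V]

lemma integral_residual [Fintype (covariateLaw f).support] (x : V) :
    ∫ z, residual f x z ∂f.toMeasure = 0 := by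
  rw [integral_toMeasure_eq_sum_profiles]
  refine Finset.sum_eq_zero fun y _ => ?_
  by_cases h : (y : V) = x
  · subst h
    simp only [residual, outcome, if_true, Bool.false_eq_true, if_false]
    ring
  · simp [residual, h]

lemma integral_indicator_profile [Fintype (covariateLaw f).support] {x : V}
    (hx : x ∈ (covariateLaw f).support) :
    open Classical in
    ∫ z : V × Bool, (if z.1 = x then (1 : ℝ) else 0) ∂f.toMeasure = (covariateLaw f x).toReal := by
  classical
  rw [integral_toMeasure_eq_sum_profiles, Finset.sum_eq_single (⟨x, hx⟩ : (covariateLaw f).support)]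
  · simp
  · intro y _ hy
    have : (y : V) ≠ x := fun h => hy (Subtype.ext h)
    simp [this]
  · simp

variable [Countable V]

lemma memLp_residual (hf : Nondegenerate f) {x : V} (hx : x ∈ (covariateLaw f).support) :
    MemLp (residual f x) 2 f.toMeasure :=
  MemLp.of_bound (measurable_of_countable _).aestronglyMeasurable _
    (Eventually.of_forall fun z => abs_residual_le hf hx z)

lemma tendsto_sampleLaw_profileCount_lt [Fintype (covariateLaw f).support]
    {x : V} (hx : x ∈ (covariateLaw f).support) {ρ : ℝ} (hρ : ρ < 1) :
    Tendsto (fun N : ℕ => sampleLaw f N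
      {D | profileCount D x < ρ * N * (covariateLaw f x).toReal}) atTop (𝓝 0) := by
  classical
  have hw := toReal_covariateLaw_pos hx
  have hmem : MemLp (fun z : V × Bool => if z.1 = x then (1 : ℝ) else 0) 2 f.toMeasure :=
    MemLp.of_bound (measurable_of_countable _).aestronglyMeasurable 1
      (Eventually.of_forall fun z => by split_ifs <;> simp)
  have h := tendsto_measure_pi_abs_sum_sub hmem
    (mul_pos (sub_pos.2 hρ) hw)
  have hint := integral_indicator_profile hx
  refine tendsto_of_tendsto_of_tendsto_of_le_of_le tendsto_const_nhds h (fun _ => zero_le)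
    fun N => measure_mono fun D hD => ?_
  simp only [Set.mem_ofPred_eq, profileCount] at hD ⊢
  have hint' : ∫ z : V × Bool, (if z.1 = x then (1 : ℝ) else 0) ∂f.toMeasure =
    (covariateLaw f x).toReal := by convert hint
  rw [hint', le_abs']
  left
  have : ∑ i, (if (D i).1 = x then (1 : ℝ) else 0) < ρ * N * (covariateLaw f x).toReal := by
    convert hD
  linarith

lemma tendsto_sampleLaw_residualSum_gt (hf : Nondegenerate f) [Fintype (covariateLaw f).support]
    {x : V} (hx : x ∈ (covariateLaw f).support) {c : ℝ} (hc : 0 < c) :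
    Tendsto (fun N : ℕ => sampleLaw f N {D | c * √N < residualSum f D x}) atTop (𝓝 0) := by
  have h := tendsto_measure_pi_abs_sum_sub (memLp_residual hf hx) hc
  rw [integral_residual] at h
  refine tendsto_of_tendsto_of_tendsto_of_le_of_le' tendsto_const_nhds h
    (Eventually.of_forall fun _ => zero_le) ?_
  filter_upwards [eventually_ge_atTop 1] with N hN
  refine measure_mono fun D hD => ?_
  simp only [Set.mem_ofPred_eq, residualSum] at hD ⊢
  have hs : 0 < √(N : ℝ) := Real.sqrt_pos.2 (by exact_mod_cast hN)
  rw [lt_inv_mul_iff₀ hs] at hD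
  have hsq : √(N : ℝ) * √(N : ℝ) = N := Real.mul_self_sqrt (Nat.cast_nonneg N)
  rw [mul_zero, sub_zero, le_abs]
  left
  nlinarith

lemma sampleLaw_exists_notMem_support (N : ℕ) :
    sampleLaw f N {D | ∃ i, (D i).1 ∉ (covariateLaw f).support} = 0 := by
  have hset : {D : Fin N → V × Bool | ∃ i, (D i).1 ∉ (covariateLaw f).support} =
      ⋃ i, Function.eval i ⁻¹' {z | z.1 ∉ (covariateLaw f).support} := by
    ext D; simp
  rw [hset, measure_iUnion_null_iff]
  intro i
  have hm : MeasurableSet {z : V × Bool | z.1 ∉ (covariateLaw f).support} := .of_discrete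
  unfold sampleLaw
  rw [(measurePreserving_eval (fun _ : Fin N => f.toMeasure) i).measure_preimage
    hm.nullMeasurableSet, PMF.toMeasure_apply_eq_zero_iff _ hm, Set.disjoint_left]
  exact fun z hz hz' => hz' (fst_mem_support hz)

/-- A record has one profile, so at most one residual in the support is nonzero; the residual vector
is therefore centered with identity covariance, and the limit law has independent coordinates. -/
lemma limsup_sampleLaw_residualSum_mem_le (hf : Nondegenerate f)
    [Fintype (covariateLaw f).support] {F : Set ((covariateLaw f).support → ℝ)}
    (hF : IsClosed F) :
    limsup (fun N : ℕ => sampleLaw f N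
      {D | (fun x : (covariateLaw f).support => residualSum f D x) ∈ F}) atTop ≤
      (Measure.pi fun _ : (covariateLaw f).support => gaussianReal 0 1) F := by
  have hX : Measurable (residualVec f) := measurable_of_countable _
  have hν : stdGaussian (EuclideanSpace ℝ (covariateLaw f).support) (WithLp.ofLp ⁻¹' F) =
      (Measure.pi fun _ : (covariateLaw f).support => gaussianReal 0 1) F := by
    rw [← map_pi_eq_stdGaussian, Measure.map_apply (by fun_prop)
      ((hF.preimage (PiLp.continuous_ofLp 2 _)).measurableSet)]
    rfl
  have h := limsup_measure_pi_closed_le (P := f.toMeasure) hX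
    (fun e _ => by
      rw [integral_toMeasure_eq_sum_profiles]
      refine Finset.sum_eq_zero fun x _ => ?_
      rw [inner_residualVec, inner_residualVec]
      simp [outcome]; ring_nf; simp)
    -- The Bernoulli variance at x times the mass of x is `profileScale f x ^ 2`, so the second
    -- moment along e is the sum of the e x ^ 2, that is ‖e‖² = 1.
    (fun e he => by
      rw [integral_toMeasure_eq_sum_profiles]
      have h2 : ‖e‖ ^ 2 = ∑ x, e x ^ 2 := EuclideanSpace.real_norm_sq_eq e
      rw [he, one_pow] at h2
      refine Eq.trans (Finset.sum_congr rfl fun x _ => ?_) h2.symm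
      rw [inner_residualVec, inner_residualVec]
      have ha := hf.profileScale_pos x.2
      have hsq := hf.profileScale_sq x.2
      simp only [outcome, if_true, Bool.false_eq_true, if_false, sub_zero, mul_pow, div_pow]
      rw [show (covariateLaw f x).toReal * (condProb f x * ((condProb f x - 1) ^ 2 /
        profileScale f x ^ 2 * e x ^ 2) + (1 - condProb f x) * (condProb f x ^ 2 /
        profileScale f x ^ 2 * e x ^ 2)) = (covariateLaw f x).toReal *
        (condProb f x * (1 - condProb f x)) / profileScale f x ^ 2 * e x ^ 2 by ring,
        ← hsq, div_self (by positivity), one_mul])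
    (fun t => charFun_stdGaussian t)
    (hF.preimage (PiLp.continuous_ofLp 2 _))
  rw [hν] at h
  refine le_trans (le_of_eq ?_) h
  congr 1
  ext N
  unfold sampleLaw
  congr 1
  ext D
  simp only [Set.mem_ofPred_eq, Set.mem_preimage]
  have : (fun x : (covariateLaw f).support => residualSum f D x) =
      ((√(N : ℝ))⁻¹ • ∑ i, residualVec f (D i)).ofLp := by
    ext x
    simp [residualSum, residualVec]
  rw [this]

end Data

/-! ### Bias Scan scores outside a bad set of data -/

section Scan

variable {V : Type u}

/-- The data sets at which some log-likelihood ratio may exceed the critical value. -/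
def badData (f : PMF (V × Bool)) [Fintype (covariateLaw f).support] (ρ η δ τ : ℝ) (N : ℕ) :
    Set (Fin N → V × Bool) :=
  ((({D | ∃ i, (D i).1 ∉ (covariateLaw f).support} ∪
    ⋃ x : (covariateLaw f).support, {D | profileCount D x < ρ * N * (covariateLaw f x).toReal}) ∪
    ⋃ x : (covariateLaw f).support,
      {D | ρ / (1 + η) * η * profileScale f x * √N < residualSum f D x}) ∪
    {D | (fun x : (covariateLaw f).support => residualSum f D x) ∈
      exceedSet (fun x : (covariateLaw f).support => profileScale f x) δ τ})

/-- Only the exceedance event survives in the limit: records off the support have probability 0, and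
the count and residual deviations vanish by the law of large numbers. -/
lemma limsup_sampleLaw_badData_le [Countable V] [MeasurableSpace V] [MeasurableSingletonClass V]
    {f : PMF (V × Bool)} (hf : Nondegenerate f) [Fintype (covariateLaw f).support]
    {ρ η δ τ : ℝ} (hρ : 0 < ρ) (hρ1 : ρ < 1) (hη : 0 < η) :
    limsup (fun N : ℕ => sampleLaw f N (badData f ρ η δ τ N)) atTop ≤
      (Measure.pi fun _ : (covariateLaw f).support => gaussianReal 0 1)
        (exceedSet (fun x : (covariateLaw f).support => profileScale f x) δ τ) := by
  have h1 : Tendsto (fun N : ℕ => ∑ x : (covariateLaw f).support, sampleLaw f N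
      {D | profileCount D x < ρ * N * (covariateLaw f x).toReal}) atTop (𝓝 0) := by
    have := tendsto_finsetSum (Finset.univ : Finset (covariateLaw f).support) fun x _ =>
      tendsto_sampleLaw_profileCount_lt x.2 hρ1
    simpa using this
  have h2 : Tendsto (fun N : ℕ => ∑ x : (covariateLaw f).support, sampleLaw f N
      {D | ρ / (1 + η) * η * profileScale f x * √N < residualSum f D x}) atTop (𝓝 0) := by
    have := tendsto_finsetSum (Finset.univ : Finset (covariateLaw f).support) fun x _ =>
      tendsto_sampleLaw_residualSum_gt hf x.2 (c := ρ / (1 + η) * η * profileScale f x)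
        (by have := hf.profileScale_pos x.2; positivity)
    simpa using this
  have h3 := limsup_sampleLaw_residualSum_mem_le hf
    (isClosed_exceedSet (fun x : (covariateLaw f).support => profileScale f x) δ τ)
  have h12 := h1.add h2
  rw [add_zero] at h12
  refine le_trans ?_ ((ENNReal.limsup_add_of_left_tendsto_zero h12 _).le.trans h3)
  refine limsup_le_limsup (Eventually.of_forall fun N => ?_)
  simp only [Pi.add_apply]
  unfold badData
  refine le_trans (measure_union_le (μ := sampleLaw f N) _ _) (add_le_add ?_ le_rfl)
  refine le_trans (measure_union_le (μ := sampleLaw f N) _ _)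
    (add_le_add ?_ (measure_iUnion_fintype_le (sampleLaw f N) _))
  refine le_trans (measure_union_le (μ := sampleLaw f N) _ _) ?_
  rw [sampleLaw_exists_notMem_support, zero_add]
  exact measure_iUnion_fintype_le (sampleLaw f N) _

lemma score_le_of_notMem_badData {f : PMF (V × Bool)} (hf : Nondegenerate f)
    [Fintype (covariateLaw f).support] [Nonempty (covariateLaw f).support]
    {N : ℕ} (hN : 0 < N) {D : Fin N → V × Bool} {ρ η δ τ B : ℝ} (hδ : 0 ≤ δ) (hρ : 0 < ρ)
    (hη : 0 < η)
    (hB : maxMean * Fintype.card (covariateLaw f).support +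
      (τ + δ) * √(Fintype.card (covariateLaw f).support) + 1 ≤ B)
    (hρη : (|B| + 1) / (|B| + 2) ≤ ρ / (1 + η)) (hD : D ∉ badData f ρ η δ τ N) {p : V → ℝ}
    (hp : ∀ x ∈ (covariateLaw f).support,
      |p x - condProb f x| < (1 - condProb f x) / (2 * (N + 1)))
    (S : Set V) : score p D S ≤ ((B + 2 : ℝ) : EReal) := by
  simp only [badData, Set.mem_union, Set.mem_iUnion, Set.mem_ofPred_eq, not_or, not_exists,
    not_not, not_lt] at hD
  obtain ⟨⟨⟨h1, h2⟩, h3⟩, h4⟩ := hD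
  refine iSup₂_le fun q hq => EReal.coe_le_coe_iff.2 ?_
  have h5 := logLikelihoodRatio_le_of_notMem_exceedSet hf hN h1 hδ hρ hη hB hρη
    (fun x hx => h2 ⟨x, hx⟩) (fun x hx => h3 ⟨x, hx⟩) h4 S hq
  have h6 := logLikelihoodRatio_le_add_one (fun i => hf _ (h1 i)) (fun i => hp _ (h1 i)) S hq
  linarith

end Scan

lemma isProbabilityMeasure_sampleLaw {V : Type u} [MeasurableSpace V] (f : PMF (V × Bool))
    (n : ℕ) : IsProbabilityMeasure (sampleLaw f n) := by
  unfold sampleLaw; infer_instance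

/-! ### The limits in the training and test sample sizes -/

section Product

variable {Q : ℕ} {Val : Fin Q → Type u} [∀ j, MeasurableSpace (Val j)]
  {ftrain f : PMF ((∀ j, Val j) × Bool)}
  {c : Classifier.{u, w} (∀ j, Val j)}

/-- An exceedance needs bad test data or a prediction off by at least `e x` at some profile. The
second event concerns only the training stage and vanishes by consistency at the finitely many
profiles. -/
lemma limsup_exceedProb_le_badData (hf : Nondegenerate f) [Fintype (covariateLaw f).support]
    [Nonempty (covariateLaw f).support]
    (hbias : ∀ x ∈ (covariateLaw f).support, condProb ftrain x = condProb f x)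
    (hcons : c.IsConsistent ftrain)
    (hsupp : (covariateLaw f).support ⊆ (covariateLaw ftrain).support)
    {N : ℕ} (hN : 0 < N) {ρ η δ τ B h : ℝ} (hδ : 0 ≤ δ) (hρ : 0 < ρ) (hη : 0 < η)
    (hB : maxMean * Fintype.card (covariateLaw f).support +
      (τ + δ) * √(Fintype.card (covariateLaw f).support) + 1 ≤ B)
    (hρη : (|B| + 1) / (|B| + 2) ≤ ρ / (1 + η)) (hh : B + 2 ≤ h) :
    limsup (fun n : ℕ => exceedProb c ftrain f n N h) atTop ≤
      sampleLaw f N (badData f ρ η δ τ N) := by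
  set e : (covariateLaw f).support → ℝ := fun x => (1 - condProb f x) / (2 * (N + 1)) with he
  have hpred : Tendsto (fun n : ℕ => ∑ x : (covariateLaw f).support, c.trainLaw ftrain n
      {z | e x ≤ |c.predict n z.1 z.2 x - condProb ftrain x|}) atTop (𝓝 0) := by
    have := tendsto_finsetSum (Finset.univ : Finset (covariateLaw f).support) fun x _ =>
      hcons x (hsupp x.2) (e x)
        (div_pos (sub_pos.2 (hf x x.2).2) (by positivity))
    simpa using this
  have hbound : ∀ n : ℕ, exceedProb c ftrain f n N h ≤ sampleLaw f N (badData f ρ η δ τ N) +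
      ∑ x : (covariateLaw f).support, c.trainLaw ftrain n
        {z | e x ≤ |c.predict n z.1 z.2 x - condProb ftrain x|} := by
    intro n
    have := isProbabilityMeasure_sampleLaw f N
    have := isProbabilityMeasure_sampleLaw ftrain n
    have : IsProbabilityMeasure (c.trainLaw ftrain n) := by
      unfold Classifier.trainLaw; infer_instance
    have hsub : {z : (Fin N → (∀ j, Val j) × Bool) × ((Fin n → (∀ j, Val j) × Bool) × c.Seed) |
        (h : EReal) < maxScore (c.predict n z.2.1 z.2.2) z.1} ⊆
        (badData f ρ η δ τ N ×ˢ Set.univ) ∪ (Set.univ ×ˢ ⋃ x : (covariateLaw f).support,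
          {z | e x ≤ |c.predict n z.1 z.2 x - condProb ftrain x|}) := by
      rintro ⟨D, z⟩ hz
      by_contra hcon
      simp only [Set.mem_union, Set.mem_prod, Set.mem_univ, and_true, true_and, Set.mem_iUnion,
        Set.mem_ofPred_eq, not_or, not_exists, not_le] at hcon
      obtain ⟨hD, hz'⟩ := hcon
      have hle : maxScore (c.predict n z.1 z.2) D ≤ ((B + 2 : ℝ) : EReal) := by
        refine iSup₂_le fun S _ => score_le_of_notMem_badData hf hN hδ hρ hη hB hρη hD ?_ S
        intro x hx
        have := hz' ⟨x, hx⟩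
        simp only [hbias x hx, he] at this
        exact this
      exact absurd hz (not_lt.2 (hle.trans (EReal.coe_le_coe_iff.2 hh)))
    unfold exceedProb
    refine (measure_mono hsub).trans ((measure_union_le _ _).trans (add_le_add ?_ ?_))
    · rw [Measure.prod_prod, measure_univ, mul_one]
    · rw [Measure.prod_prod, measure_univ, one_mul]
      exact measure_iUnion_fintype_le _ _
  refine (limsup_le_limsup (Eventually.of_forall hbound)).trans ?_
  rw [(tendsto_const_nhds.add hpred).limsup_eq, add_zero]

lemma limsup_limsup_exceedProb_le [∀ j, Countable (Val j)]
    [∀ j, MeasurableSingletonClass (Val j)] (hf : Nondegenerate f)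
    [Fintype (covariateLaw f).support]
    [Nonempty (covariateLaw f).support]
    (hbias : ∀ x ∈ (covariateLaw f).support, condProb ftrain x = condProb f x)
    (hcons : c.IsConsistent ftrain)
    (hsupp : (covariateLaw f).support ⊆ (covariateLaw ftrain).support)
    {δ τ h : ℝ} (hδ : 0 ≤ δ)
    (hh : maxMean * Fintype.card (covariateLaw f).support +
      (τ + δ) * √(Fintype.card (covariateLaw f).support) + 4 ≤ h) :
    limsup (fun N : ℕ => limsup (fun n : ℕ => exceedProb c ftrain f n N h) atTop) atTop ≤
      (Measure.pi fun _ : (covariateLaw f).support => gaussianReal 0 1)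
        (exceedSet (fun x : (covariateLaw f).support => profileScale f x) δ τ) := by
  -- Two units are reserved: one for the factor ρ/(1 + η), one for replacing the predictions by the
  -- true probabilities.
  set B := h - 2 with hB
  set r := (|B| + 1) / (|B| + 2) with hr
  have hr0 : 0 < r := by positivity
  have hr1 : r < 1 := by rw [hr, div_lt_one (by positivity)]; linarith
  -- ρ lies strictly between r and 1, and η = ρ/r - 1 > 0 gives ρ/(1 + η) = r exactly.
  set ρ := (1 + r) / 2 with hρ
  have hρ1 : ρ < 1 := by rw [hρ]; linarith
  have hη : 0 < ρ / r - 1 := by rw [sub_pos, lt_div_iff₀ hr0, hρ]; linarith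
  have hρη : r ≤ ρ / (1 + (ρ / r - 1)) := by
    have : 0 < ρ := by positivity
    rw [add_sub_cancel, div_div_cancel₀ this.ne']
  refine le_trans (limsup_le_limsup ?_)
    (limsup_sampleLaw_badData_le hf (by positivity : 0 < ρ) hρ1 hη (δ := δ) (τ := τ))
  filter_upwards [eventually_gt_atTop 0] with N hN
  exact limsup_exceedProb_le_badData hf hbias hcons hsupp hN hδ (by positivity) hη
    (by linarith) hρη (by linarith)

end Product

/-! ### Identification of the constants k₁ and k₂ -/

lemma isGreatest_censoredMean : IsGreatest (censoredMean '' Set.Ioi 0) maxMean := by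
  have h := meanArgmax_mem.1
  constructor
  · refine ⟨optScale, optScale_pos, ?_⟩
    rw [censoredMean_eq optScale_pos]
    unfold optScale maxMean
    congr 1; ring
  · rintro _ ⟨t, ht, rfl⟩
    rw [censoredMean_eq ht]
    exact callMean_le (div_nonneg (le_of_lt ht) two_pos.le)

lemma isGreatest_censoredVariance :
    IsGreatest (censoredVariance '' Set.Ioi 0) (maxDev ^ 2) := by
  have h := varArgmax_mem.1
  have h2 : (0 : ℝ) < 2 * varArgmax := by linarith
  rw [maxDev_sq]
  constructor
  · refine ⟨2 * varArgmax, h2, ?_⟩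
    rw [censoredVariance_eq h2, mul_div_cancel_left₀ _ two_ne_zero]
  · rintro _ ⟨t, ht, rfl⟩
    rw [censoredVariance_eq ht]
    exact sq_mul_callVar_le (div_nonneg (le_of_lt ht) two_pos.le)

lemma maxDev_bounds : |maxDev - 0.523| ≤ 0.0005 := by
  have h0 : 0 ≤ maxDev := Real.sqrt_nonneg _
  obtain ⟨h1, h2⟩ := sq_mul_callVar_varArgmax_bounds
  rw [← maxDev_sq] at h1 h2
  have h3 := (pow_le_pow_iff_left₀ (by norm_num) h0 two_ne_zero).1 h1
  have h4 := (pow_le_pow_iff_left₀ h0 (by norm_num) two_ne_zero).1 h2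
  rw [abs_le]; constructor <;> linarith

end

end BiasScan

/-! ### The main theorem -/

theorem theorem2 :
    ∃ k₁ k₂ : ℝ,
      IsGreatest (BiasScan.censoredMean '' Set.Ioi 0) k₁ ∧
      0 ≤ k₂ ∧ IsGreatest (BiasScan.censoredVariance '' Set.Ioi 0) (k₂ ^ 2) ∧
      |k₁ - 0.202| ≤ 0.0005 ∧ |k₂ - 0.523| ≤ 0.0005 ∧
      ∀ α ε : ℝ, 0 < α → 0 ≤ ε → (α < 1 / 2 ∨ (α = 1 / 2 ∧ 0 < ε)) →
        ∃ M₀ : ℕ, ∀ M : ℕ, M₀ ≤ M →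
          ∀ (Q : ℕ) (Val : Fin Q → Type u) [∀ j, Countable (Val j)]
            [∀ j, MeasurableSpace (Val j)] [∀ j, MeasurableSingletonClass (Val j)]
            (ftrain ftest : PMF ((∀ j, Val j) × Bool))
            (c : BiasScan.Classifier.{u, w} (∀ j, Val j)),
            -- unbiased training data
            (∀ x ∈ (BiasScan.covariateLaw ftest).support,
              BiasScan.condProb ftrain x = BiasScan.condProb ftest x) →
            -- consistency of the classifier
            c.IsConsistent ftrain →
            -- full support of the training data
            (BiasScan.covariateLaw ftest).support ⊆ (BiasScan.covariateLaw ftrain).support →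
            -- positivity
            (∀ x ∈ (BiasScan.covariateLaw ftest).support,
              0 < BiasScan.condProb ftest x ∧ BiasScan.condProb ftest x < 1) →
            -- finitely many covariate profiles, `M` in number
            (BiasScan.covariateLaw ftest).support.Finite →
            (BiasScan.covariateLaw ftest).support.ncard = M →
            limsup (fun N : ℕ =>
                limsup (fun n : ℕ =>
                  BiasScan.exceedProb c ftrain ftest n N (BiasScan.threshold k₁ k₂ M α)) atTop)
              atTop ≤ ENNReal.ofReal (α + ε) := by
  refine ⟨BiasScan.maxMean, BiasScan.maxDev, BiasScan.isGreatest_censoredMean, Real.sqrt_nonneg _,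
    BiasScan.isGreatest_censoredVariance, BiasScan.callMean_meanArgmax_bounds,
    BiasScan.maxDev_bounds, fun α ε hα hε h => ?_⟩
  obtain ⟨δ, τ, hδ, M₀, hM₀⟩ := BiasScan.exists_uniform_gaussian_bound.{u} hα hε h
  refine ⟨M₀, fun M hM Q Val _ _ _ ftrain ftest c hbias hcons hsupp hpos hfin hcard => ?_⟩
  have : Fintype (BiasScan.covariateLaw ftest).support := hfin.fintype
  have hM' : M = Fintype.card (BiasScan.covariateLaw ftest).support := by
    rw [← hcard, ← Nat.card_coe_set_eq, Nat.card_eq_fintype_card]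
  obtain ⟨h1, h2, h3⟩ := hM₀ (BiasScan.covariateLaw ftest).support (hM' ▸ hM)
  have : Nonempty (BiasScan.covariateLaw ftest).support := Fintype.card_pos_iff.1 h1
  rw [hM']
  exact (BiasScan.limsup_limsup_exceedProb_le hpos hbias hcons hsupp hδ.le h2).trans
    (h3 _ fun x => BiasScan.Nondegenerate.profileScale_pos hpos x.2)
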